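/- A CSP instance $I=(V,D,C)$ consists of a finite set $V$ of variables, a finite domain $D$ and a set $C$ of constraints $\langle s,R\rangle$, where $s$ is a tuple of variables (the scope) and $R$ is a relation over $D$ of the same arity, given by the list of its tuples; a solution is a map $f\colon V\to D$ such that $f(s)\in R$ for every $\langle s,R\rangle\in C$. The primal graph of $I$ has vertex set $V$, two distinct variables being adjacent if they occur together in the scope of some constraint. Call $I$ *simple binary* if every constraint has arity $2$ and two distinct variables in its scope, and no two constraints are on the same pair of variables. For $r\in\mathbb N$ let $s_r$ be the infimum of all real numbers $\delta$ for which there is an algorithm that decides $r$-SAT (satisfiability of formulas in conjunctive normal form, given as sets of clauses with at most $r$ literals each) on $n$ variables in time $O(2^{\delta n})$. The Strong Exponential-Time Hypothesis (SETH) is the statement $\lim_{r\to\infty}s_r=1$. Algorithms are programs of a unit-cost random access machine in which a run of $t$ steps on an input of size $N$ uses words of $O(\log(N+t))$ bits. **Theorem.** Let $k\ge 3$ and $c\ge 1$ be integers, let $\varepsilon>0$ be a real number, and let $\mathcal C$ be a class of CSP instances that contains every simple binary instance (for example, the class of all CSP instances, or the class of simple binary instances). Suppose that there is an algorithm that decides,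 for every instance $I=(V,D,C)$ in $\mathcal C$ with $V,D\neq\emptyset$ whose primal graph has treewidth at most $k$, whether $I$ has a solution, and that runs on these instances in time $O(|V|^c\cdot|D|^{k-\varepsilon})$. Then SETH is false. -/

import Mathlib

open Filter Topology

/-! ### Random access machines

The machine model is the usual unit-cost random access machine with words of logarithmic length.
Programs are finite structured programs over registers and zero-initialised arrays of natural
numbers; a program mentions only finitely many registers and arrays. Every elementary operation and
every test costs one step. -/

/-- Arithmetic and bitwise operations available as single instructions. -/
inductive BinOp where
  | add | sub | mul | div | mod | land | lor | xor | shl | shr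

/-- The value of an operation (`sub` is truncated, division by zero gives zero). -/
def BinOp.eval : BinOp → ℕ → ℕ → ℕ
  | .add, a, b => a + b
  | .sub, a, b => a - b
  | .mul, a, b => a * b
  | .div, a, b => a / b
  | .mod, a, b => a % b
  | .land, a, b => a &&& b
  | .lor, a, b => a ||| b
  | .xor, a, b => a ^^^ b
  | .shl, a, b => a <<< b
  | .shr, a, b => a >>> b

/-- Programs. Registers and arrays are named by natural numbers. -/
inductive Prog where
  /-- do nothing -/
  | skip : Prog
  /-- `const r n`: register `r` receives the constant `n` -/
  | const (r n : ℕ) : Prog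
  /-- `op o r a b`: register `r` receives the result of `o` on registers `a` and `b` -/
  | op (o : BinOp) (r a b : ℕ) : Prog
  /-- `load r A i`: register `r` receives the entry of array `A` at the index held by register `i` -/
  | load (r A i : ℕ) : Prog
  /-- `store A i r`: the entry of array `A` at the index held by register `i` receives register `r` -/
  | store (A i r : ℕ) : Prog
  /-- sequential composition -/
  | seq (P Q : Prog) : Prog
  /-- `ite r P Q`: run `P` if register `r` is nonzero, and `Q` otherwise -/
  | ite (r : ℕ) (P Q : Prog) : Prog
  /-- `loop r P`: while register `r` is nonzero, run `P` -/
  | loop (r : ℕ) (P : Prog) : Prog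

/-- Memory contents: registers, and arrays indexed by natural numbers. -/
structure Store where
  reg : ℕ → ℕ
  arr : ℕ → ℕ → ℕ

/-- Write `v` to register `r`. -/
def Store.setReg (s : Store) (r v : ℕ) : Store :=
  { s with reg := Function.update s.reg r v }

/-- Write `v` to entry `i` of array `A`. -/
def Store.setArr (s : Store) (A i v : ℕ) : Store :=
  { s with arr := Function.update s.arr A (Function.update (s.arr A) i v) }

/-- `Exec B P s t s'`: started in `s`, the program `P` halts in `s'` after exactly `t` steps, and
every number that it computes is at most `B`. -/
inductive Exec (B : ℕ) : Prog → Store → ℕ → Store → Prop where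
  | skip (s : Store) : Exec B .skip s 1 s
  | const (s : Store) (r n : ℕ) (h : n ≤ B) : Exec B (.const r n) s 1 (s.setReg r n)
  | op (s : Store) (o : BinOp) (r a b : ℕ) (h : o.eval (s.reg a) (s.reg b) ≤ B) :
      Exec B (.op o r a b) s 1 (s.setReg r (o.eval (s.reg a) (s.reg b)))
  | load (s : Store) (r A i : ℕ) : Exec B (.load r A i) s 1 (s.setReg r (s.arr A (s.reg i)))
  | store (s : Store) (A i r : ℕ) : Exec B (.store A i r) s 1 (s.setArr A (s.reg i) (s.reg r))
  | seq {P Q : Prog} {s s' s'' : Store} {t t' : ℕ} (hP : Exec B P s t s')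
      (hQ : Exec B Q s' t' s'') : Exec B (.seq P Q) s (t + t') s''
  | iteTrue {r : ℕ} {P Q : Prog} {s s' : Store} {t : ℕ} (hr : s.reg r ≠ 0)
      (hP : Exec B P s t s') : Exec B (.ite r P Q) s (t + 1) s'
  | iteFalse {r : ℕ} {P Q : Prog} {s s' : Store} {t : ℕ} (hr : s.reg r = 0)
      (hQ : Exec B Q s t s') : Exec B (.ite r P Q) s (t + 1) s'
  | loopDone {r : ℕ} {P : Prog} {s : Store} (hr : s.reg r = 0) : Exec B (.loop r P) s 1 s
  | loopStep {r : ℕ} {P : Prog} {s s' s'' : Store} {t t' : ℕ} (hr : s.reg r ≠ 0)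
      (hP : Exec B P s t s') (hloop : Exec B (.loop r P) s' t' s'') :
      Exec B (.loop r P) s (t + t' + 1) s''

/-- The initial memory on input `x`: array `0` holds `x`, register `0` holds the length of `x`, and
everything else is zero. -/
def Store.init (x : List ℕ) : Store where
  reg r := if r = 0 then x.length else 0
  arr A i := if A = 0 then x.getD i 0 else 0

/-- The number of words of the input, plus its largest entry. -/
def inputSize (x : List ℕ) : ℕ := x.length + x.foldr max 0

/-- The decision problem with instances in `S`, encoding `enc` and yes-instances `yes` is solvable in
time `O(f)`: there is a fixed program that, on every instance `a` in `S`, halts after at most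
`K * f a` steps, with register `0` nonzero exactly if `a` is a yes-instance. On an input of size `N`
a run of `t` steps may use words of `O(log (N + t))` bits, that is, numbers polynomial in `N + t`.
Nothing is required on instances outside `S`. -/
def SolvableInTime {α : Type} (S : Set α) (enc : α → List ℕ) (yes : α → Prop) (f : α → ℝ) : Prop :=
  ∃ (P : Prog) (w : ℕ) (K : ℝ), ∀ a ∈ S, ∃ (t : ℕ) (s : Store),
    Exec ((inputSize (enc a) + t + 1) ^ w) P (Store.init (enc a)) t s ∧
      (s.reg 0 ≠ 0 ↔ yes a) ∧ (t : ℝ) ≤ K * f a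

/-! ### Satisfiability and the Strong Exponential-Time Hypothesis -/

/-- A formula in conjunctive normal form on `numVars` variables: a set of clauses, listed without
repetition. A clause is a list of literals `(v, b)`, which is the variable `v` if `b` is true and
its negation otherwise. -/
structure CNF where
  numVars : ℕ
  clauses : List (List (Fin numVars × Bool))
  nodup : clauses.Nodup

namespace CNF

/-- Every clause has at most `k` literals. -/
def IsKCNF (φ : CNF) (k : ℕ) : Prop := ∀ c ∈ φ.clauses, c.length ≤ k

/-- Some assignment makes a literal of every clause true. -/
def Satisfiable (φ : CNF) : Prop :=
  ∃ a : Fin φ.numVars → Bool, ∀ c ∈ φ.clauses, ∃ l ∈ c, a l.1 = l.2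

/-- The number of variables, the number of clauses, and then every clause, as its length followed
by its literals. -/
def encode (φ : CNF) : List ℕ :=
  φ.numVars :: φ.clauses.length ::
    φ.clauses.flatMap fun c => c.length :: c.map fun l => 2 * (l.1 : ℕ) + l.2.toNat

end CNF

/-- The infimum `s_k` of all real `δ` such that `k`-SAT on `n` variables can be solved in time
`O(2 ^ (δ n))`. -/
noncomputable def satExponent (k : ℕ) : EReal :=
  sInf ((fun δ : ℝ => (δ : EReal)) ''
    {δ : ℝ | SolvableInTime {φ : CNF | φ.IsKCNF k} CNF.encode CNF.Satisfiable
      fun φ => (2 : ℝ) ^ (δ * (φ.numVars : ℝ))})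

/-- The Strong Exponential-Time Hypothesis: `s_k` tends to `1` as `k` tends to infinity. -/
def SETH : Prop := Tendsto satExponent atTop (𝓝 1)

/-! ### Treewidth -/

/-- A tree decomposition of a graph. -/
structure TreeDecomposition {V : Type} (G : SimpleGraph V) where
  Node : Type
  fintypeNode : Fintype Node
  tree : SimpleGraph Node
  isTree : tree.IsTree
  bag : Node → Finset V
  cover : ∀ v, ∃ t, v ∈ bag t
  edge : ∀ v w, G.Adj v w → ∃ t, v ∈ bag t ∧ w ∈ bag t
  connected : ∀ v, (tree.induce {t | v ∈ bag t}).Connected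

/-- The largest bag size minus one. -/
def TreeDecomposition.width {V : Type} {G : SimpleGraph V} (D : TreeDecomposition G) : ℕ :=
  letI := D.fintypeNode
  Finset.univ.sup fun t => (D.bag t).card - 1

/-- The least width of a tree decomposition. -/
noncomputable def treewidth {V : Type} (G : SimpleGraph V) : ℕ∞ :=
  ⨅ D : TreeDecomposition G, (D.width : ℕ∞)

/-! ### Constraint satisfaction problems -/

/-- A constraint on `n` variables over a domain with `d` values: a scope, which is a tuple of
variables, and a relation of the same arity, given by its tuples listed without repetition. -/
structure CSPConstraint (n d : ℕ) where
  arity : ℕ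
  scope : Fin arity → Fin n
  tuples : List (Fin arity → Fin d)
  nodup : tuples.Nodup

/-- An instance `(V, D, C)` of the constraint satisfaction problem, with `V = {0, …, numVars - 1}`
and `D = {0, …, numVals - 1}`. -/
structure CSPInstance where
  numVars : ℕ
  numVals : ℕ
  constraints : List (CSPConstraint numVars numVals)
  nodup : constraints.Nodup

namespace CSPInstance

/-- Some assignment of values to the variables satisfies every constraint. -/
def HasSolution (I : CSPInstance) : Prop :=
  ∃ f : Fin I.numVars → Fin I.numVals, ∀ c ∈ I.constraints, (fun i => f (c.scope i)) ∈ c.tuples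

/-- Two distinct variables are adjacent if they occur together in the scope of a constraint. -/
def primalGraph (I : CSPInstance) : SimpleGraph (Fin I.numVars) where
  Adj x y := x ≠ y ∧ ∃ c ∈ I.constraints, x ∈ Set.range c.scope ∧ y ∈ Set.range c.scope
  symm := ⟨fun _ _ h => ⟨h.1.symm, h.2.imp fun _ hc => ⟨hc.1, hc.2.2, hc.2.1⟩⟩⟩
  loopless := ⟨fun _ h => h.1 rfl⟩

/-- Every constraint is binary, on two distinct variables, and no two constraints are on the same
pair of variables. -/
def IsSimpleBinary (I : CSPInstance) : Prop :=
  (∀ c ∈ I.constraints, c.arity = 2 ∧ Function.Injective c.scope) ∧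
    I.constraints.Pairwise fun c c' => Set.range c.scope ≠ Set.range c'.scope

/-- The numbers of variables, values and constraints, and then every constraint, as its arity, its
scope, the number of tuples in its relation, and these tuples. -/
def encode (I : CSPInstance) : List ℕ :=
  I.numVars :: I.numVals :: I.constraints.length ::
    I.constraints.flatMap fun c =>
      c.arity :: (List.ofFn fun i => (c.scope i : ℕ)) ++
        c.tuples.length :: c.tuples.flatMap fun u => List.ofFn fun i => (u i : ℕ)

end CSPInstance

/-! ### Reasoning about programs -/

/-! The idea is to encode `r`-SAT with a small clause gadget whose primal graph is bipartite with
only `k` vertices on one side. Split the `n` propositional variables into `k` groups of `p = n / k +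
2 * k`. One CSP variable per group ranges over the `2 ^ p` assignments to that group, and one CSP
variable per clause names a group that makes the clause true. The constraint between clause `j` and
group `i` forbids the clause variable to be `i` when the assignment to group `i` satisfies no
literal of the clause; the values `b < k` with `b ≠ i` are always allowed. To give all relations the
same number of tuples, a forbidden `i` is replaced by the dummy value `k + i` instead of being
dropped. This is harmless: the dummy of group `i` is rejected by the constraint with any other
group. Hence solutions correspond to satisfying assignments (`hasSolution_inst`, `satisfiable_iff`).
A star-shaped decomposition, with the group variables in every bag and one clause variable in each
leaf, has width at most `k` (`treewidth_le_of_adj`). The assumed algorithm spends `2 ^ (p * (k -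
ε))` steps, at most a constant times `2 ^ ((1 - ε / k) * n)`, up to a factor polynomial in the
number of clauses. There are at most `(2 * n + 1) ^ r` clauses, so half of the saving absorbs this
factor (`exists_time_bound`). Writing the instance takes about `2 ^ p` steps per clause, which is
cheaper once `ε ≤ 1`. Thus every `s_r` is at most `1 - ε / (2 * k)`, with a bound independent of
`r`, and the limit cannot be `1`. Most of the work is to carry this out on the machine. The
reduction is an explicit program whose loops are verified with invariants and step counts
(`prog_spec`). It leaves its output in array `1` with the length in register `32`, and touches
nothing beyond, so the assumed algorithm, renamed by `Prog.shift 32 1`, finds its own initial memory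
there (`exec_shift`). -/

namespace Store

@[simp] theorem reg_setReg (s : Store) (r v r' : ℕ) :
    (s.setReg r v).reg r' = if r' = r then v else s.reg r' := by
  simp [setReg, Function.update_apply]

@[simp] theorem arr_setReg (s : Store) (r v : ℕ) : (s.setReg r v).arr = s.arr := rfl

@[simp] theorem reg_setArr (s : Store) (A i v : ℕ) : (s.setArr A i v).reg = s.reg := rfl

@[simp] theorem arr_setArr (s : Store) (A i v A' : ℕ) :
    (s.setArr A i v).arr A' = if A' = A then Function.update (s.arr A) i v else s.arr A' := by
  simp [setArr, Function.update_apply]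

end Store

namespace Exec

theorem mono {B B' : ℕ} (hB : B ≤ B') {P : Prog} {s s' : Store} {t : ℕ} (h : Exec B P s t s') :
    Exec B' P s t s' := by
  induction h with
  | skip s => exact .skip s
  | const s r n h => exact .const s r n (h.trans hB)
  | op s o r a b h => exact .op s o r a b (h.trans hB)
  | load s r A i => exact .load s r A i
  | store s A i r => exact .store s A i r
  | seq _ _ h₁ h₂ => exact .seq h₁ h₂
  | iteTrue hr _ h => exact .iteTrue hr h
  | iteFalse hr _ h => exact .iteFalse hr h
  | loopDone hr => exact .loopDone hr
  | loopStep hr _ _ h₁ h₂ => exact .loopStep hr h₁ h₂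

end Exec

/-! ### Renaming, frames and straight-line programs -/

namespace Prog

/-- The program with register `r` renamed to `r + m` and array `A` renamed to `A + n`. -/
def shift (m n : ℕ) : Prog → Prog
  | skip => skip
  | const r v => const (r + m) v
  | op o r a b => op o (r + m) (a + m) (b + m)
  | load r A i => load (r + m) (A + n) (i + m)
  | store A i r => store (A + n) (i + m) (r + m)
  | seq P Q => seq (P.shift m n) (Q.shift m n)
  | ite r P Q => ite (r + m) (P.shift m n) (Q.shift m n)
  | loop r P => loop (r + m) (P.shift m n)

/-- The program may write to register `r`. -/
def writesReg (r : ℕ) : Prog → Bool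
  | skip => false
  | const r' _ => r' == r
  | op _ r' _ _ => r' == r
  | load r' _ _ => r' == r
  | store _ _ _ => false
  | seq P Q => P.writesReg r || Q.writesReg r
  | ite _ P Q => P.writesReg r || Q.writesReg r
  | loop _ P => P.writesReg r

/-- The program may write to array `A`. -/
def writesArr (A : ℕ) : Prog → Bool
  | skip => false
  | const _ _ => false
  | op _ _ _ _ => false
  | load _ _ _ => false
  | store A' _ _ => A' == A
  | seq P Q => P.writesArr A || Q.writesArr A
  | ite _ P Q => P.writesArr A || Q.writesArr A
  | loop _ P => P.writesArr A

/-- The two stores agree on everything that the program does not write. -/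
def Frame (P : Prog) (s s' : Store) : Prop :=
  (∀ r, P.writesReg r = false → s'.reg r = s.reg r) ∧
    ∀ A, P.writesArr A = false → s'.arr A = s.arr A

theorem Frame.refl (P : Prog) (s : Store) : P.Frame s s := ⟨fun _ _ => rfl, fun _ _ => rfl⟩

theorem Frame.trans {P : Prog} {s s' s'' : Store} (h : P.Frame s s') (h' : P.Frame s' s'') :
    P.Frame s s'' :=
  ⟨fun r hr => (h'.1 r hr).trans (h.1 r hr), fun A hA => (h'.2 A hA).trans (h.2 A hA)⟩

/-- The effect of a program without tests. -/
def run : Prog → Store → Store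
  | const r n, s => s.setReg r n
  | op o r a b, s => s.setReg r (o.eval (s.reg a) (s.reg b))
  | load r A i, s => s.setReg r (s.arr A (s.reg i))
  | store A i r, s => s.setArr A (s.reg i) (s.reg r)
  | seq P Q, s => Q.run (P.run s)
  | _, s => s

/-- The program has no tests, and started in `s` it computes only numbers that are at most `B`. -/
def Safe (B : ℕ) : Prog → Store → Prop
  | skip, _ => True
  | const _ n, _ => n ≤ B
  | op o _ a b, s => o.eval (s.reg a) (s.reg b) ≤ B
  | load _ _ _, _ => True
  | store _ _ _, _ => True
  | seq P Q, s => P.Safe B s ∧ Q.Safe B (P.run s)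
  | _, _ => False

/-- The number of steps of a program without tests. -/
def cost : Prog → ℕ
  | seq P Q => P.cost + Q.cost
  | _ => 1

/-- Sequential composition of a list of programs. -/
def block : List Prog → Prog
  | [] => skip
  | [P] => P
  | P :: Q :: l => seq P (block (Q :: l))

end Prog

namespace Exec

variable {B : ℕ} {P : Prog} {s s' : Store} {t : ℕ}

theorem of_safe (h : P.Safe B s) : Exec B P s P.cost (P.run s) := by
  induction P generalizing s with
  | skip => exact .skip s
  | const r n => exact .const s r n h
  | op o r a b => exact .op s o r a b h
  | load r A i => exact .load s r A i
  | store A i r => exact .store s A i r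
  | seq P Q hP hQ => exact .seq (hP h.1) (hQ h.2)
  | ite => exact h.elim
  | loop => exact h.elim

theorem frame (h : Exec B P s t s') : P.Frame s s' := by
  induction h with
  | skip s => exact .refl _ _
  | const s r n h =>
    refine ⟨fun r' hr => ?_, fun _ _ => rfl⟩
    simp only [Prog.writesReg, beq_eq_false_iff_ne] at hr
    simp [hr.symm]
  | op s o r a b h =>
    refine ⟨fun r' hr => ?_, fun _ _ => rfl⟩
    simp only [Prog.writesReg, beq_eq_false_iff_ne] at hr
    simp [hr.symm]
  | load s r A i =>
    refine ⟨fun r' hr => ?_, fun _ _ => rfl⟩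
    simp only [Prog.writesReg, beq_eq_false_iff_ne] at hr
    simp [hr.symm]
  | store s A i r =>
    refine ⟨fun _ _ => rfl, fun A' hA => ?_⟩
    simp only [Prog.writesArr, beq_eq_false_iff_ne] at hA
    simp [hA.symm]
  | seq _ _ h₁ h₂ =>
    simp only [Prog.Frame, Prog.writesReg, Prog.writesArr, Bool.or_eq_false_iff] at *
    exact ⟨fun r hr => (h₂.1 r hr.2).trans (h₁.1 r hr.1),
      fun A hA => (h₂.2 A hA.2).trans (h₁.2 A hA.1)⟩
  | iteTrue hr _ h =>
    simp only [Prog.Frame, Prog.writesReg, Prog.writesArr, Bool.or_eq_false_iff] at *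
    exact ⟨fun r hr => h.1 r hr.1, fun A hA => h.2 A hA.1⟩
  | iteFalse hr _ h =>
    simp only [Prog.Frame, Prog.writesReg, Prog.writesArr, Bool.or_eq_false_iff] at *
    exact ⟨fun r hr => h.1 r hr.2, fun A hA => h.2 A hA.2⟩
  | loopDone hr => exact .refl _ _
  | loopStep hr _ _ h₁ h₂ => exact Prog.Frame.trans (P := .loop _ _) h₁ h₂

/-- A renamed program simulates the original one. -/
theorem shift (m n : ℕ) (h : Exec B P s t s') {σ : Store} (hreg : ∀ r, σ.reg (r + m) = s.reg r)
    (harr : ∀ A, σ.arr (A + n) = s.arr A) :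
    ∃ σ', Exec B (P.shift m n) σ t σ' ∧ (∀ r, σ'.reg (r + m) = s'.reg r) ∧
      ∀ A, σ'.arr (A + n) = s'.arr A := by
  induction h generalizing σ with
  | skip s => exact ⟨σ, .skip σ, hreg, harr⟩
  | const s r v h =>
    exact ⟨_, .const σ _ v h, fun r' => by simp [hreg], fun A => by simp [harr]⟩
  | op s o r a b h =>
    refine ⟨_, .op σ o _ _ _ (by rwa [hreg, hreg]), fun r' => by simp [hreg],
      fun A => by simp [harr]⟩
  | load s r A i =>
    exact ⟨_, .load σ _ _ _, fun r' => by simp [hreg, harr], fun A => by simp [harr]⟩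
  | store s A i r =>
    exact ⟨_, .store σ _ _ _, fun r' => by simp [hreg], fun A => by simp [harr, hreg]⟩
  | seq _ _ h₁ h₂ =>
    obtain ⟨σ₁, e₁, hr₁, ha₁⟩ := h₁ hreg harr
    obtain ⟨σ₂, e₂, hr₂, ha₂⟩ := h₂ hr₁ ha₁
    exact ⟨σ₂, .seq e₁ e₂, hr₂, ha₂⟩
  | iteTrue hr _ h =>
    obtain ⟨σ₁, e₁, hr₁, ha₁⟩ := h hreg harr
    exact ⟨σ₁, .iteTrue (by rwa [hreg]) e₁, hr₁, ha₁⟩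
  | iteFalse hr _ h =>
    obtain ⟨σ₁, e₁, hr₁, ha₁⟩ := h hreg harr
    exact ⟨σ₁, .iteFalse (by rwa [hreg]) e₁, hr₁, ha₁⟩
  | loopDone hr => exact ⟨σ, .loopDone (by rwa [hreg]), hreg, harr⟩
  | loopStep hr _ _ h₁ h₂ =>
    obtain ⟨σ₁, e₁, hr₁, ha₁⟩ := h₁ hreg harr
    obtain ⟨σ₂, e₂, hr₂, ha₂⟩ := h₂ hr₁ ha₁
    exact ⟨σ₂, .loopStep (by rwa [hreg]) e₁ e₂, hr₂, ha₂⟩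

end Exec

/-- Started in `s`, the program halts within `T` steps in a store that satisfies `Q`, computing only
numbers that are at most `B`. -/
def Terminates (B : ℕ) (P : Prog) (s : Store) (T : ℕ) (Q : Store → Prop) : Prop :=
  ∃ t s', t ≤ T ∧ Exec B P s t s' ∧ Q s'

/-! ### Rules for total correctness with step bounds -/

namespace Terminates

variable {B T T' : ℕ} {P P' : Prog} {s : Store} {Q Q' : Store → Prop}

theorem of_safe (h : P.Safe B s) (hQ : Q (P.run s)) : Terminates B P s P.cost Q :=
  ⟨_, _, le_rfl, .of_safe h, hQ⟩

theorem mono (h : Terminates B P s T Q) (hT : T ≤ T') (hQ : ∀ s', Q s' → Q' s') :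
    Terminates B P s T' Q' := by
  obtain ⟨t, s', ht, he, hs⟩ := h
  exact ⟨t, s', ht.trans hT, he, hQ _ hs⟩

theorem seq (h : Terminates B P s T Q)
    (h' : ∀ s', P.Frame s s' → Q s' → Terminates B P' s' T' Q') :
    Terminates B (P.seq P') s (T + T') Q' := by
  obtain ⟨t, s', ht, he, hs⟩ := h
  obtain ⟨t', s'', ht', he', hs'⟩ := h' s' he.frame hs
  exact ⟨_, _, add_le_add ht ht', .seq he he', hs'⟩

/-- A loop that runs `N` times, with invariant `I`. -/
theorem loop {c N : ℕ} {I : ℕ → Store → Prop} (h0 : I 0 s) (hc : ∀ j s, I j s → s.reg c = N - j)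
    (hb : ∀ j < N, ∀ s', I j s' → P.Frame s s' → Terminates B P s' T (I (j + 1))) :
    Terminates B (.loop c P) s (N * (T + 1) + 1) (I N) := by
  suffices H : ∀ d j s', N = j + d → P.Frame s s' → I j s' →
      Terminates B (.loop c P) s' (d * (T + 1) + 1) (I N) from H N 0 s (by simp) (.refl _ _) h0
  intro d
  induction d with
  | zero =>
    intro j s' hN _ hI
    have hj := hc j s' hI
    exact ⟨1, s', by simp, .loopDone (by omega), by simpa [hN] using hI⟩
  | succ d ih =>
    intro j s' hN hF hI
    have hj := hc j s' hI
    obtain ⟨t₁, s₁, ht₁, e₁, h₁⟩ := hb j (by omega) s' hI hF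
    obtain ⟨t₂, s₂, ht₂, e₂, h₂⟩ := ih (j + 1) s₁ (by omega) (hF.trans e₁.frame) h₁
    exact ⟨_, _, by linarith, .loopStep (by omega) e₁ e₂, h₂⟩

end Terminates

/-- Each round lowers the counter by only one. A lower bound on time is needed because the
admissible word length grows with the running time: the countdown pays for handling numbers as large
as its counter. -/
theorem Exec.reg_le_of_loop_sub {B c d : ℕ} {s s' : Store} {t : ℕ} (hcd : d ≠ c)
    (hd : s.reg d = 1) (h : Exec B (.loop c (.op .sub c c d)) s t s') : s.reg c ≤ t := by
  generalize hL : Prog.loop c (.op .sub c c d) = L at h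
  induction h with
  | loopDone hr => cases hL; omega
  | loopStep hr h₁ h₂ _ ih =>
    cases hL
    cases h₁
    have := ih (by simpa [hcd] using hd) rfl
    simp only [Store.reg_setReg, BinOp.eval, reduceIte, hd] at this
    omega
  | _ => cases hL

/-- The contents of an array that holds the list `L` and is zero elsewhere. -/
def arrOf (L : List ℕ) : ℕ → ℕ := fun i => L.getD i 0

theorem update_arrOf {L : List ℕ} {i : ℕ} (h : i = L.length) (v : ℕ) :
    Function.update (arrOf L) i v = arrOf (L ++ [v]) := by
  subst h
  funext i
  rcases lt_trichotomy i L.length with h | h | h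
  · simp [arrOf, h.ne, List.getD_eq_getElem?_getD, List.getElem?_append_left h]
  · subst h; simp [arrOf, List.getD_eq_getElem?_getD]
  · have : (L ++ [v]).length ≤ i := by simp; omega
    simp [arrOf, h.ne', List.getD_eq_getElem?_getD, List.getElem?_eq_none this,
      List.getElem?_eq_none h.le]

theorem arrOf_append_right (L L' : List ℕ) (i : ℕ) : arrOf (L ++ L') (L.length + i) = arrOf L' i := by
  simp [arrOf, List.getD_eq_getElem?_getD, List.getElem?_append_right]

theorem arrOf_append_left (L L' : List ℕ) {i : ℕ} (h : i < L.length) :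
    arrOf (L ++ L') i = arrOf L i := by
  simp [arrOf, List.getD_eq_getElem?_getD, List.getElem?_append_left h]

/-! ### The program of the reduction -/

namespace Reduction

open Prog

/-- `1` if the literal with code `l` is about a variable of group `i`, where groups have `p`
variables, and is made true by the assignment with code `a` to that group, and `0` otherwise. -/
def litVal (p i a l : ℕ) : ℕ :=
  1 - (l / 2 / p - i + (i - l / 2 / p) + (a >>> (l / 2 % p) % 2 - l % 2) +
    (l % 2 - a >>> (l / 2 % p) % 2))

/-- The number of literals of a clause made true by the assignment `a` to group `i`. -/
def hits (p i a : ℕ) (cl : List ℕ) : ℕ := (cl.map (litVal p i a)).sum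

/-- The second entry of the tuple with index `(a, b)`. -/
def entry (k p i a b : ℕ) (cl : List ℕ) : ℕ :=
  k * ((1 - (b - i + (i - b))) * (1 - hits p i a cl)) + b

/-- The tuples that start with `a`. -/
def row (k p i : ℕ) (cl : List ℕ) (a : ℕ) : List ℕ :=
  (List.range k).flatMap fun b => [a, entry k p i a b cl]

/-- The code of the constraint between group `i` and clause `j`. -/
def constraintCode (k p j : ℕ) (cl : List ℕ) (i : ℕ) : List ℕ :=
  [2, i, k + j, 2 ^ p * k] ++ (List.range (2 ^ p)).flatMap (row k p i cl)

/-- The code of all constraints on clause `j`. -/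
def clauseCode (k p j : ℕ) (cl : List ℕ) : List ℕ :=
  (List.range k).flatMap (constraintCode k p j cl)

/-- The code of the instance for the clauses `cls`. -/
def code (k p : ℕ) (cls : List (List ℕ)) : List ℕ :=
  [k + cls.length, 2 ^ p, cls.length * k] ++
    (List.range cls.length).flatMap fun j => clauseCode k p j (cls.getD j [])

theorem length_flatMap_range {f : ℕ → List ℕ} {c : ℕ} (h : ∀ i, (f i).length = c) (n : ℕ) :
    ((List.range n).flatMap f).length = n * c := by
  simp [List.length_flatMap, h]

theorem length_row (k p i : ℕ) (cl : List ℕ) (a : ℕ) : (row k p i cl a).length = k * 2 :=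
  length_flatMap_range (f := fun b => [a, entry k p i a b cl]) (fun _ => rfl) k

theorem length_constraintCode (k p j : ℕ) (cl : List ℕ) (i : ℕ) :
    (constraintCode k p j cl i).length = 4 + 2 ^ p * (k * 2) := by
  rw [constraintCode, List.length_append, length_flatMap_range (length_row k p i cl)]; rfl

theorem length_clauseCode (k p j : ℕ) (cl : List ℕ) :
    (clauseCode k p j cl).length = k * (4 + 2 ^ p * (k * 2)) :=
  length_flatMap_range (length_constraintCode k p j cl) k

theorem length_code (k p : ℕ) (cls : List (List ℕ)) :
    (code k p cls).length = 3 + cls.length * (k * (4 + 2 ^ p * (k * 2))) := by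
  rw [code, List.length_append, length_flatMap_range (fun j => length_clauseCode k p j _)]; rfl

/-- Append register `r` to the list in array `1`. -/
def emit (r : ℕ) : Prog := seq (store 1 32 r) (op .add 32 32 1)

/-- Test one literal. -/
def litProg : Prog := block
  [load 22 0 17, op .div 23 22 24, op .mod 22 22 24, op .div 25 23 6, op .mod 23 23 6,
   op .shr 23 14 23, op .mod 23 23 24, op .sub 26 25 12, op .sub 27 12 25, op .add 26 26 27,
   op .sub 27 23 22, op .add 26 26 27, op .sub 27 22 23, op .add 26 26 27, op .sub 26 1 26,
   op .add 16 16 26, op .add 17 17 1, op .sub 18 18 1]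

/-- Write one tuple. -/
def tupleProg : Prog := block
  [emit 14, op .sub 23 19 12, op .sub 22 12 19, op .add 23 23 22, op .sub 23 1 23, op .sub 22 1 16,
   op .mul 23 23 22, op .mul 23 4 23, op .add 23 23 19, emit 23, op .add 19 19 1, op .sub 20 20 1]

/-- Write the tuples that start with a given value. -/
def rowProg (k : ℕ) : Prog := seq
  (block [const 16 0, const 2 0, op .add 17 9 2, op .add 18 21 2]) <| seq
  (loop 18 litProg) <| seq
  (block [const 19 0, const 20 k]) <| seq
  (loop 20 tupleProg)
  (block [op .add 14 14 1, op .sub 15 15 1])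

/-- Write one constraint. -/
def constraintProg (k : ℕ) : Prog := seq
  (block [emit 24, emit 12, emit 10, emit 8, const 14 0, const 2 0, op .add 15 7 2]) <| seq
  (loop 15 (rowProg k))
  (block [op .add 12 12 1, op .sub 13 13 1])

/-- Write the constraints on one clause. -/
def clauseProg (k : ℕ) : Prog := seq
  (block [load 21 0 9, op .add 9 9 1, const 12 0, const 13 k]) <| seq
  (loop 13 (constraintProg k))
  (block [op .add 9 9 21, op .add 10 10 1, op .sub 11 11 1])

/-- Compute the parameters. -/
def paramProg (k : ℕ) : Prog := block
  [const 1 1, const 24 2, const 4 k, const 2 0, load 3 0 2, load 5 0 1, op .div 6 3 4,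
   op .add 6 6 4, op .add 6 6 4, op .shl 7 1 6, op .mul 8 7 4, op .add 2 7 2]

/-- Count down from the number of values. -/
def padProg : Prog := loop 2 (op .sub 2 2 1)

/-- Write the code of the whole instance. -/
def outputProg (k : ℕ) : Prog := seq
  (block [op .add 3 4 5, emit 3, emit 7, op .mul 3 5 4, emit 3, op .add 9 24 2, op .add 10 4 2,
    op .add 11 5 2])
  (loop 11 (clauseProg k))

/-- Array `1` and register `32` hold the list `L` and its length. -/
def Output (s : Store) (L : List ℕ) : Prop := s.reg 32 = L.length ∧ s.arr 1 = arrOf L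

/-- The registers with fixed contents. -/
structure Env (k p : ℕ) (x : List ℕ) (s : Store) : Prop where
  reg_one : s.reg 1 = 1
  reg_two : s.reg 24 = 2
  reg_k : s.reg 4 = k
  reg_p : s.reg 6 = p
  reg_d : s.reg 7 = 2 ^ p
  reg_dk : s.reg 8 = 2 ^ p * k
  arr_x : s.arr 0 = arrOf x

/-- Whether a program writes to a given place is computed from its syntax, so for concrete programs
the side conditions hold by `rfl`. -/
theorem Env.frame {k p : ℕ} {x : List ℕ} {s s' : Store} {P : Prog} (h : Env k p x s)
    (hF : P.Frame s s') (h1 : P.writesReg 1 = false := by rfl)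
    (h24 : P.writesReg 24 = false := by rfl) (h4 : P.writesReg 4 = false := by rfl)
    (h6 : P.writesReg 6 = false := by rfl) (h7 : P.writesReg 7 = false := by rfl)
    (h8 : P.writesReg 8 = false := by rfl) (h0 : P.writesArr 0 = false := by rfl) :
    Env k p x s' :=
  ⟨(hF.1 _ h1).trans h.reg_one, (hF.1 _ h24).trans h.reg_two, (hF.1 _ h4).trans h.reg_k,
    (hF.1 _ h6).trans h.reg_p, (hF.1 _ h7).trans h.reg_d, (hF.1 _ h8).trans h.reg_dk,
    (hF.2 _ h0).trans h.arr_x⟩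

theorem hits_take_succ {p i a q : ℕ} {cl : List ℕ} (hq : q < cl.length) :
    hits p i a (cl.take (q + 1)) = hits p i a (cl.take q) + litVal p i a cl[q] := by
  rw [hits, hits, List.take_succ_eq_append_getElem hq, List.map_append, List.sum_append]
  rfl

theorem litVal_le (p i a l : ℕ) : litVal p i a l ≤ 1 := Nat.sub_le _ _

theorem hits_le (p i a : ℕ) (cl : List ℕ) : hits p i a cl ≤ cl.length := by
  induction cl with
  | nil => simp [hits]
  | cons l cl ih =>
    have := litVal_le p i a l
    simp only [hits, List.map_cons, List.sum_cons, List.length_cons] at *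
    omega

theorem entry_le {k p i a b : ℕ} {cl : List ℕ} : entry k p i a b cl ≤ k + b := by
  have : (1 - (b - i + (i - b))) * (1 - hits p i a cl) ≤ 1 * 1 :=
    Nat.mul_le_mul (Nat.sub_le _ _) (Nat.sub_le _ _)
  have := Nat.mul_le_mul_left k this
  rw [entry]
  omega

/-! ### Correctness and step counts of the nested loops -/

variable {B k p : ℕ} {x : List ℕ} {s : Store}

theorem litLoop_spec {cl pre post : List ℕ} {i a : ℕ} (hE : Env k p x s)
    (hx : x = pre ++ cl ++ post) (hi : s.reg 12 = i) (ha : s.reg 14 = a)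
    (h16 : s.reg 16 = 0) (h17 : s.reg 17 = pre.length) (h18 : s.reg 18 = cl.length)
    (hB : ∀ l ∈ cl, l + i + 4 ≤ B) (hxB : x.length ≤ B) (haB : a ≤ B) :
    Terminates B (loop 18 litProg) s (cl.length * 19 + 1) fun s' =>
      s'.reg 16 = hits p i a cl := by
  refine (Terminates.loop (T := 18) (N := cl.length) (I := fun q s' => q ≤ cl.length ∧
    s'.reg 16 = hits p i a (cl.take q) ∧ s'.reg 17 = pre.length + q ∧ s'.reg 18 = cl.length - q)
    ?_ (fun j s' h => h.2.2.2) ?_).mono le_rfl fun s' h => by simpa using h.2.1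
  · simp [h16, h17, h18, hits]
  · rintro q hq s' ⟨-, h16, h17, h18⟩ hF
    have hE' := hE.frame hF
    have hi' := (hF.1 12 rfl).trans hi
    have ha' := (hF.1 14 rfl).trans ha
    have hl : s'.arr 0 (pre.length + q) = cl[q] := by
      rw [hE'.arr_x, hx, List.append_assoc, arrOf_append_right, arrOf_append_left _ _ hq]
      simp [arrOf, hq]
    have hlB := hB _ (List.getElem_mem hq)
    have hh := hits_le p i a (cl.take q)
    have hs := hits_take_succ (p := p) (i := i) (a := a) hq
    have hlen : pre.length + cl.length ≤ x.length := by simp [hx]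
    replace hh := hh.trans (List.length_take_le _ _)
    rw [litVal] at hs
    set l := cl[q]
    have h1 : a >>> (l / 2 % p) ≤ a := by rw [Nat.shiftRight_eq_div_pow]; exact Nat.div_le_self _ _
    have h2 : l / 2 / p ≤ l := (Nat.div_le_self _ _).trans (Nat.div_le_self _ _)
    have h3 : l / 2 % p ≤ l := (Nat.mod_le _ _).trans (Nat.div_le_self _ _)
    have h4 : a >>> (l / 2 % p) % 2 < 2 := Nat.mod_lt _ (by norm_num)
    have h5 : l % 2 < 2 := Nat.mod_lt _ (by norm_num)
    have h6 : l / 2 ≤ l := Nat.div_le_self _ _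
    refine (Terminates.of_safe (P := litProg) ?_ ?_ : Terminates _ _ _ 18 _)
    · simp only [litProg, block, Safe, run, Store.reg_setReg, BinOp.eval,
        hE'.reg_one, hE'.reg_two, hE'.reg_p, hi', ha', h16, h17, h18, hl, reduceIte,
        Nat.reduceEqDiff]
      -- With quotients, remainders and shifts made opaque, all the word bounds are linear.
      generalize l / 2 % p = u at *
      generalize l / 2 / p = v at *
      generalize a >>> u = w at *
      generalize w % 2 = z at *
      clear_value l; refine ⟨trivial, ?_, ?_, ?_, ?_, ?_, ?_, ?_, ?_, ?_, ?_, ?_, ?_, ?_, ?_, ?_, ?_, ?_⟩ <;> omega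
    · simp only [litProg, block, run, Store.reg_setReg, BinOp.eval,
        hE'.reg_one, hE'.reg_two, hE'.reg_p, hi', ha', h16, h17, h18, hl, reduceIte,
        Nat.reduceEqDiff]
      refine ⟨hq, hs.symm, ?_, ?_⟩ <;> omega

theorem tupleLoop_spec {cl L : List ℕ} {i a : ℕ} (hE : Env k p x s) (hL : Output s L)
    (hi : s.reg 12 = i) (ha : s.reg 14 = a) (h16 : s.reg 16 = hits p i a cl)
    (h19 : s.reg 19 = 0) (h20 : s.reg 20 = k) (hB : L.length + k * 2 ≤ B) (hi : i < k)
    (hkB : 2 * k + 1 ≤ B) :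
    Terminates B (loop 20 tupleProg) s (k * 15 + 1) fun s' =>
      Output s' (L ++ row k p i cl a) := by
  refine (Terminates.loop (T := 14) (N := k) (I := fun b s' => b ≤ k ∧ s'.reg 19 = b ∧
    s'.reg 20 = k - b ∧ Output s' (L ++ (List.range b).flatMap fun b => [a, entry k p i a b cl]))
    ?_ (fun j s' h => h.2.2.1) ?_).mono le_rfl fun s' h => h.2.2.2
  · simpa [h19, h20] using hL
  · rintro b hb s' ⟨-, h19, h20, hO⟩ hF
    have hE' := hE.frame hF
    have hi' := (hF.1 12 rfl).trans ‹s.reg 12 = i›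
    have ha' := (hF.1 14 rfl).trans ha
    have h16' := (hF.1 16 rfl).trans h16
    have he := entry_le (k := k) (p := p) (i := i) (a := a) (b := b) (cl := cl)
    have hlen := length_flatMap_range (c := 2) (f := fun b => [a, entry k p i a b cl]) (fun _ => rfl) b
    have he1 : (1 - (b - i + (i - b))) * (1 - hits p i a cl) ≤ 1 * 1 :=
      Nat.mul_le_mul (Nat.sub_le _ _) (Nat.sub_le _ _)
    rw [List.range_succ, List.flatMap_append, ← List.append_assoc]
    have hlen' : (L ++ (List.range b).flatMap fun b => [a, entry k p i a b cl]).length =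
      L.length + b * 2 := by rw [List.length_append, hlen]
    generalize (L ++ (List.range b).flatMap fun b => [a, entry k p i a b cl]) = M at *
    obtain ⟨h32, hA⟩ := hO
    refine (Terminates.of_safe (P := tupleProg) ?_ ?_ : Terminates _ _ _ 14 _)
    · simp only [tupleProg, emit, block, Safe, run, Store.reg_setReg, BinOp.eval,
        Store.reg_setArr, true_and,
        hE'.reg_one, hE'.reg_k, hi', ha', h16', h19, h20, h32, reduceIte,
        Nat.reduceEqDiff]
      rw [← entry]
      have : k * ((1 - (b - i + (i - b))) * (1 - hits p i a cl)) ≤ entry k p i a b cl :=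
        Nat.le_add_right _ _
      omega
    · simp only [tupleProg, emit, block, run, Store.reg_setReg, Store.arr_setReg, BinOp.eval,
        Store.reg_setArr, Store.arr_setArr, Output,
        hE'.reg_one, hE'.reg_k, hi', ha', h16', h19, h20, h32, hA, reduceIte,
        Nat.reduceEqDiff]
      refine ⟨hb, trivial, by omega, by simp, ?_⟩
      rw [← entry, update_arrOf rfl, update_arrOf (by simp)]
      simp

theorem rowLoop_spec {cl L pre post : List ℕ} {i : ℕ} (hE : Env k p x s) (hL : Output s L)
    (hx : x = pre ++ cl ++ post) (h9 : s.reg 9 = pre.length) (h21 : s.reg 21 = cl.length)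
    (h12 : s.reg 12 = i) (h14 : s.reg 14 = 0) (h15 : s.reg 15 = 2 ^ p) (hi : i < k)
    (hB : L.length + 2 ^ p * (k * 2) ≤ B) (hlB : ∀ l ∈ cl, l + k + 4 ≤ B) (hxB : x.length ≤ B)
    (hkB : 2 * k + 1 ≤ B) (hpB : 2 ^ p ≤ B) :
    Terminates B (loop 15 (rowProg k)) s (2 ^ p * (cl.length * 19 + k * 15 + 11) + 1) fun s' =>
      Output s' (L ++ (List.range (2 ^ p)).flatMap (row k p i cl)) := by
  refine (Terminates.loop (T := cl.length * 19 + k * 15 + 10) (N := 2 ^ p)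
    (I := fun a s' => a ≤ 2 ^ p ∧ s'.reg 14 = a ∧
      s'.reg 15 = 2 ^ p - a ∧ Output s' (L ++ (List.range a).flatMap (row k p i cl)))
    ?_ (fun j s' h => h.2.2.1) ?_).mono le_rfl fun s' h => h.2.2.2
  · simpa [h14, h15] using hL
  · rintro a ha s' ⟨-, h14, h15, hO⟩ hF
    have hE' := hE.frame hF
    have h12' := (hF.1 12 rfl).trans h12
    have h9' := (hF.1 9 rfl).trans h9
    have h21' := (hF.1 21 rfl).trans h21
    have hlen : pre.length + cl.length ≤ x.length := by simp [hx]
    rw [List.range_succ, List.flatMap_append, ← List.append_assoc, List.flatMap_singleton]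
    have hM : (L ++ (List.range a).flatMap (row k p i cl)).length + k * 2 ≤ B := by
      rw [List.length_append, length_flatMap_range (length_row k p i cl)]
      have := Nat.mul_le_mul_right (k * 2) (Nat.succ_le_of_lt ha)
      rw [Nat.succ_mul] at this
      omega
    generalize L ++ (List.range a).flatMap (row k p i cl) = M at *
    refine Terminates.mono (T := 4 + ((cl.length * 19 + 1) + (2 + ((k * 15 + 1) + 2))))
      (Terminates.seq (Q := fun s₁ => s₁.reg 16 = 0 ∧ s₁.reg 17 = pre.length ∧
          s₁.reg 18 = cl.length) (.of_safe ?_ ?_) fun s₁ hF₁ ⟨h16, h17, h18⟩ =>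
        (litLoop_spec (hE'.frame hF₁) hx ((hF₁.1 12 rfl).trans h12') ((hF₁.1 14 rfl).trans h14)
          h16 h17 h18 (fun l hl => by have := hlB l hl; omega) hxB (by omega)).seq
        fun s₂ hF₂ h₂ => Terminates.seq (Q := fun s₃ => s₃.reg 19 = 0 ∧ s₃.reg 20 = k)
          (.of_safe ?_ ?_) fun s₃ hF₃ ⟨h19, h20⟩ =>
        (tupleLoop_spec (L := M) (((hE'.frame hF₁).frame hF₂).frame hF₃)
          ⟨((hF₃.1 32 rfl).trans (hF₂.1 32 rfl)).trans ((hF₁.1 32 rfl).trans hO.1),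
            ((hF₃.2 1 rfl).trans (hF₂.2 1 rfl)).trans ((hF₁.2 1 rfl).trans hO.2)⟩
          (((hF₃.1 12 rfl).trans (hF₂.1 12 rfl)).trans ((hF₁.1 12 rfl).trans h12'))
          (((hF₃.1 14 rfl).trans (hF₂.1 14 rfl)).trans ((hF₁.1 14 rfl).trans h14))
          ((hF₃.1 16 rfl).trans h₂) h19 h20 hM hi hkB).seq fun s₄ hF₄ h₄ =>
        .of_safe (P := block [op .add 14 14 1, op .sub 15 15 1]) ?_ ?_)
      (by omega) fun s' h => h
    · simp [block, Safe, run, BinOp.eval, h9', h21']; omega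
    · simp [block, run, BinOp.eval, h9', h21']
    · simp [block, Safe]; omega
    · simp [block, run]
    all_goals
      have e1 := (((hE'.frame hF₁).frame hF₂).frame hF₃).frame hF₄ |>.reg_one
      have e2 := (hF₄.1 14 rfl).trans (((hF₃.1 14 rfl).trans (hF₂.1 14 rfl)).trans
        ((hF₁.1 14 rfl).trans h14))
      have e3 := (hF₄.1 15 rfl).trans (((hF₃.1 15 rfl).trans (hF₂.1 15 rfl)).trans
        ((hF₁.1 15 rfl).trans h15))
    · simp [block, Safe, run, BinOp.eval, e1, e2, e3]; omega
    · simp only [block, run, BinOp.eval, e1, e2, e3, Output, Store.reg_setReg, Store.arr_setReg,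
        reduceIte, Nat.reduceEqDiff]
      exact ⟨ha, trivial, by omega, h₄⟩

theorem constraintLoop_spec {cl L pre post : List ℕ} {j : ℕ} (hE : Env k p x s) (hL : Output s L)
    (hx : x = pre ++ cl ++ post) (h9 : s.reg 9 = pre.length) (h21 : s.reg 21 = cl.length)
    (h10 : s.reg 10 = k + j) (h12 : s.reg 12 = 0) (h13 : s.reg 13 = k)
    (hB : L.length + k * (4 + 2 ^ p * (k * 2)) ≤ B) (hlB : ∀ l ∈ cl, l + k + 4 ≤ B)
    (hxB : x.length ≤ B) (hkB : 2 * k + 1 ≤ B) (hpB : 2 ^ p ≤ B) :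
    Terminates B (loop 13 (constraintProg k)) s
      (k * (2 ^ p * (cl.length * 19 + k * 15 + 11) + 15) + 1) fun s' =>
      Output s' (L ++ clauseCode k p j cl) := by
  refine (Terminates.loop (T := 2 ^ p * (cl.length * 19 + k * 15 + 11) + 14) (N := k)
    (I := fun i s' => i ≤ k ∧ s'.reg 12 = i ∧
      s'.reg 13 = k - i ∧ Output s' (L ++ (List.range i).flatMap (constraintCode k p j cl)))
    ?_ (fun j s' h => h.2.2.1) ?_).mono le_rfl fun s' h => h.2.2.2
  · simpa [h12, h13] using hL
  · rintro i hi s' ⟨-, h12, h13, hO⟩ hF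
    have hE' := hE.frame hF
    have h9' := (hF.1 9 rfl).trans h9
    have h21' := (hF.1 21 rfl).trans h21
    have h10' := (hF.1 10 rfl).trans h10
    rw [List.range_succ, List.flatMap_append, ← List.append_assoc, List.flatMap_singleton]
    have hM : (L ++ (List.range i).flatMap (constraintCode k p j cl)).length +
        (4 + 2 ^ p * (k * 2)) ≤ B := by
      rw [List.length_append, length_flatMap_range (length_constraintCode k p j cl)]
      have := Nat.mul_le_mul_right (4 + 2 ^ p * (k * 2)) (Nat.succ_le_of_lt hi)
      rw [Nat.succ_mul] at this
      omega
    generalize L ++ (List.range i).flatMap (constraintCode k p j cl) = M at *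
    obtain ⟨h32, hA⟩ := hO
    refine Terminates.mono
      (T := 11 + ((2 ^ p * (cl.length * 19 + k * 15 + 11) + 1) + 2))
      (Terminates.seq (Q := fun s₁ => s₁.reg 14 = 0 ∧ s₁.reg 15 = 2 ^ p ∧
          Output s₁ (M ++ [2, i, k + j, 2 ^ p * k]))
        (.of_safe ?_ ?_) fun s₁ hF₁ ⟨h14, h15, hO₁⟩ =>
        (rowLoop_spec (hE'.frame hF₁) hO₁ hx ((hF₁.1 9 rfl).trans h9')
          ((hF₁.1 21 rfl).trans h21') ((hF₁.1 12 rfl).trans h12) h14 h15 hi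
          (by simp; omega) hlB hxB hkB hpB).seq fun s₂ hF₂ h₂ =>
        .of_safe (P := block [op .add 12 12 1, op .sub 13 13 1]) ?_ ?_)
      (by omega) fun s' h => h
    · simp only [emit, block, Safe, run, Store.reg_setReg, BinOp.eval, Store.reg_setArr,
        hE'.reg_one, hE'.reg_d, h32, reduceIte, Nat.reduceEqDiff, true_and]
      omega
    · simp only [emit, block, run, Store.reg_setReg, Store.arr_setReg, BinOp.eval, Output,
        Store.reg_setArr, Store.arr_setArr, hE'.reg_one, hE'.reg_d, h32, hA, reduceIte,
        hE'.reg_two, hE'.reg_dk, h10', h12, Nat.reduceEqDiff, true_and, add_zero]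
      refine ⟨by simp, ?_⟩
      rw [update_arrOf rfl, update_arrOf (by simp), update_arrOf (by simp), update_arrOf (by simp)]
      simp
    all_goals
      have e1 := (hE'.frame hF₁).frame hF₂ |>.reg_one
      have e2 := (hF₂.1 12 rfl).trans ((hF₁.1 12 rfl).trans h12)
      have e3 := (hF₂.1 13 rfl).trans ((hF₁.1 13 rfl).trans h13)
    · simp [block, Safe, run, BinOp.eval, e1, e2, e3]; omega
    · simp only [block, run, BinOp.eval, e1, e2, e3, Output, Store.reg_setReg, Store.arr_setReg,
        reduceIte, Nat.reduceEqDiff]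
      rw [List.append_assoc] at h₂
      exact ⟨hi, trivial, by omega, h₂⟩

/-- The code of a list of clauses. -/
def clausesCode (cls : List (List ℕ)) : List ℕ := cls.flatMap fun c => c.length :: c

theorem clauseLoop_spec {cls : List (List ℕ)} {L : List ℕ} {n m r : ℕ} (hE : Env k p x s)
    (hL : Output s L) (hx : x = [n, m] ++ clausesCode cls) (h9 : s.reg 9 = 2)
    (h10 : s.reg 10 = k) (h11 : s.reg 11 = cls.length) (hr : ∀ cl ∈ cls, cl.length ≤ r)
    (hB : L.length + cls.length * (k * (4 + 2 ^ p * (k * 2))) ≤ B)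
    (hlB : ∀ cl ∈ cls, ∀ l ∈ cl, l + k + 4 ≤ B) (hxB : x.length ≤ B) (hkB : 2 * k + 1 ≤ B)
    (hpB : 2 ^ p ≤ B) (hmB : k + cls.length ≤ B) :
    Terminates B (loop 11 (clauseProg k)) s
      (cls.length * (k * (2 ^ p * (r * 19 + k * 15 + 11) + 15) + 9) + 1) fun s' =>
      Output s' (L ++ (List.range cls.length).flatMap fun j => clauseCode k p j (cls.getD j [])) := by
  -- Clauses have varying lengths, so the invariant describes the read position, register `9`, as
  -- the length of the part of the input consumed so far.
  refine (Terminates.loop (T := k * (2 ^ p * (r * 19 + k * 15 + 11) + 15) + 8) (N := cls.length)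
    (I := fun j s' => j ≤ cls.length ∧ s'.reg 9 = ([n, m] ++ clausesCode (cls.take j)).length ∧
      s'.reg 10 = k + j ∧ s'.reg 11 = cls.length - j ∧
      Output s' (L ++ (List.range j).flatMap fun j => clauseCode k p j (cls.getD j [])))
    ?_ (fun j s' h => h.2.2.2.1) ?_).mono le_rfl fun s' h => h.2.2.2.2
  · simpa [h9, h10, h11, clausesCode] using hL
  · rintro j hj s' ⟨-, h9, h10, h11, hO⟩ hF
    have hE' := hE.frame hF
    have hcl := List.getElem_mem hj
    rw [List.range_succ, List.flatMap_append, ← List.append_assoc, List.flatMap_singleton]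
    have hM : (L ++ (List.range j).flatMap fun j => clauseCode k p j (cls.getD j [])).length +
        (k * (4 + 2 ^ p * (k * 2))) ≤ B := by
      rw [List.length_append, length_flatMap_range (fun j => length_clauseCode k p j _)]
      have := Nat.mul_le_mul_right (k * (4 + 2 ^ p * (k * 2))) (Nat.succ_le_of_lt hj)
      rw [Nat.succ_mul] at this
      omega
    generalize (L ++ (List.range j).flatMap fun j => clauseCode k p j (cls.getD j [])) = M at *
    rw [List.getD_eq_getElem _ _ hj]
    have htake : [n, m] ++ clausesCode (cls.take (j + 1)) =
        [n, m] ++ clausesCode (cls.take j) ++ [cls[j].length] ++ cls[j] := by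
      rw [List.take_succ_eq_append_getElem hj, clausesCode, List.flatMap_append,
        List.flatMap_singleton]
      simp [clausesCode]
    have hx' : x = [n, m] ++ clausesCode (cls.take (j + 1)) ++ clausesCode (cls.drop (j + 1)) := by
      rw [hx, List.append_assoc, clausesCode, clausesCode, clausesCode, ← List.flatMap_append,
        List.take_append_drop]
    rw [htake] at hx' ⊢
    have hlr := hr _ hcl
    have hlB' := hlB _ hcl
    generalize [n, m] ++ clausesCode (cls.take j) = pre at *
    generalize clausesCode (cls.drop (j + 1)) = post at *
    generalize cls[j] = cl at *
    have hload : s'.arr 0 pre.length = cl.length := by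
      rw [hE'.arr_x, hx']
      simp [arrOf]
    have hlen : pre.length + 1 + cl.length ≤ x.length := by simp [hx']; omega
    refine Terminates.mono
      (T := 4 + ((k * (2 ^ p * (cl.length * 19 + k * 15 + 11) + 15) + 1) + 3))
      (Terminates.seq (Q := fun s₁ => s₁.reg 21 = cl.length ∧ s₁.reg 9 = (pre ++ [cl.length]).length ∧
          s₁.reg 12 = 0 ∧ s₁.reg 13 = k)
        (.of_safe ?_ ?_) fun s₁ hF₁ ⟨h21, h9, h12, h13⟩ =>
        (constraintLoop_spec (hE'.frame hF₁)
          ⟨(hF₁.1 32 rfl).trans hO.1, (hF₁.2 1 rfl).trans hO.2⟩ hx' h9 h21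
          ((hF₁.1 10 rfl).trans h10) h12 h13 hM hlB' hxB hkB hpB).seq fun s₂ hF₂ h₂ =>
        .of_safe (P := block [op .add 9 9 21, op .add 10 10 1, op .sub 11 11 1]) ?_ ?_)
      ?_ fun s' h => h
    · simp [block, Safe, run, BinOp.eval, h9, hE'.reg_one]; omega
    · simp [block, run, BinOp.eval, h9, hE'.reg_one, hload]
    rotate_right
    · have : k * (2 ^ p * (cl.length * 19 + k * 15 + 11) + 15) ≤
        k * (2 ^ p * (r * 19 + k * 15 + 11) + 15) := by gcongr
      omega
    all_goals
      have e1 := (hE'.frame hF₁).frame hF₂ |>.reg_one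
      have e2 := (hF₂.1 9 rfl).trans ‹s₁.reg 9 = _›
      have e3 := (hF₂.1 21 rfl).trans h21
      have e4 := (hF₂.1 10 rfl).trans ((hF₁.1 10 rfl).trans h10)
      have e5 := (hF₂.1 11 rfl).trans ((hF₁.1 11 rfl).trans h11)
    · simp [block, Safe, run, BinOp.eval, e1, e2, e3, e4, e5]; omega
    · simp only [block, run, BinOp.eval, e1, e2, e3, e4, e5, Output, Store.reg_setReg,
        Store.arr_setReg, reduceIte, Nat.reduceEqDiff]
      exact ⟨hj, by simp; omega, by omega, by omega, h₂⟩

/-- Register `2` is zero because the padding loop has exhausted it; adding it serves as a move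
between registers. -/
theorem outputProg_spec {cls : List (List ℕ)} {n m r : ℕ} (hE : Env k p x s)
    (hL : Output s []) (hx : x = [n, m] ++ clausesCode cls) (h2 : s.reg 2 = 0)
    (h5 : s.reg 5 = cls.length) (hr : ∀ cl ∈ cls, cl.length ≤ r)
    (hB : (code k p cls).length ≤ B)
    (hlB : ∀ cl ∈ cls, ∀ l ∈ cl, l + k + 4 ≤ B) (hxB : x.length ≤ B) (hkB : 2 * k + 1 ≤ B)
    (hpB : 2 ^ p ≤ B) (hmB : k + cls.length ≤ B) (hmkB : cls.length * k ≤ B) :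
    Terminates B (outputProg k) s
      (cls.length * (k * (2 ^ p * (r * 19 + k * 15 + 11) + 15) + 9) + 12) fun s' =>
      Output s' (code k p cls) := by
  rw [length_code] at hB
  obtain ⟨h32, hA⟩ := hL
  have hx2 : 2 ≤ x.length := by simp [hx]
  refine Terminates.mono
    (T := 11 + (cls.length * (k * (2 ^ p * (r * 19 + k * 15 + 11) + 15) + 9) + 1))
    (Terminates.seq (Q := fun s₁ => s₁.reg 9 = 2 ∧ s₁.reg 10 = k ∧ s₁.reg 11 = cls.length ∧
      Output s₁ [k + cls.length, 2 ^ p, cls.length * k]) (.of_safe ?_ ?_)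
      fun s₁ hF₁ ⟨h9, h10, h11, hO⟩ =>
      clauseLoop_spec (hE.frame hF₁) hO hx h9 h10 h11 hr (by simpa using hB) hlB hxB hkB hpB hmB)
    (by omega) fun s' h => h
  · simp only [emit, block, Safe, run, Store.reg_setReg, BinOp.eval, Store.reg_setArr, h5, h2,
      hE.reg_k, hE.reg_one, hE.reg_two, h32, reduceIte, Nat.reduceEqDiff, true_and, List.length_nil]
    omega
  · simp only [emit, block, run, Store.reg_setReg, Store.arr_setReg, BinOp.eval, Output,
      Store.reg_setArr, Store.arr_setArr, hE.reg_one, hE.reg_k, h2, h5, h32, hA, reduceIte,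
      hE.reg_two, hE.reg_d, Nat.reduceEqDiff, true_and, add_zero]
    refine ⟨by simp, ?_⟩
    rw [update_arrOf rfl, update_arrOf (by simp), update_arrOf (by simp)]
    simp

theorem paramProg_spec {n m : ℕ} {cls : List (List ℕ)} (hx : x = [n, m] ++ clausesCode cls)
    (hnB : n ≤ B) (hkB : 2 * k + 1 ≤ B) (hpB : 2 ^ (n / k + 2 * k) * k ≤ B) (hk : 0 < k) :
    Terminates B (paramProg k) (Store.init x) 12 fun s =>
      Env k (n / k + 2 * k) x s ∧ Output s [] ∧ s.reg 2 = 2 ^ (n / k + 2 * k) ∧ s.reg 5 = m := by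
  have h0 : (Store.init x).arr 0 = arrOf x := by funext i; simp [Store.init, arrOf]
  have h1 : (Store.init x).arr 1 = arrOf [] := by funext i; simp [Store.init, arrOf]
  have h32 : (Store.init x).reg 32 = 0 := rfl
  have hx0 : arrOf x 0 = n := by simp [hx, arrOf]
  have hx1 : arrOf x 1 = m := by simp [hx, arrOf]
  have hdiv : n / k ≤ n := Nat.div_le_self _ _
  have hp : n / k + 2 * k < 2 ^ (n / k + 2 * k) := Nat.lt_two_pow_self
  have hp' : 2 ^ (n / k + 2 * k) ≤ 2 ^ (n / k + 2 * k) * k := Nat.le_mul_of_pos_right _ hk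
  have h3 : n / k + k + k = n / k + 2 * k := by ring
  refine Terminates.of_safe (P := paramProg k) ?_ ?_
  · simp only [paramProg, block, Safe, run, Store.reg_setReg, Store.arr_setReg, BinOp.eval, h0, hx0,
      hx1, reduceIte, Nat.reduceEqDiff, true_and, Nat.one_shiftLeft, h3]
    omega
  · refine ⟨⟨?_, ?_, ?_, ?_, ?_, ?_, ?_⟩, ⟨?_, ?_⟩, ?_, ?_⟩ <;>
    simp [paramProg, block, run, BinOp.eval, h0, h1, h32, hx0,
      hx1, Nat.one_shiftLeft, h3]

/-- The reduction. -/
def prog (k : ℕ) : Prog := seq (paramProg k) (seq padProg (outputProg k))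

/-- The lower bound `2 ^ p ≤ t` comes from the padding loop. It makes `2 ^ p` a legitimate word even
for a formula without clauses, where writing the output takes constant time. -/
theorem prog_spec {n r : ℕ} {cls : List (List ℕ)} (hp : p = n / k + 2 * k)
    (hx : x = [n, cls.length] ++ clausesCode cls)
    (hnB : n ≤ B) (hpkB : 2 ^ p * k ≤ B) (hk : 0 < k)
    (hr : ∀ cl ∈ cls, cl.length ≤ r) (hB : (code k p cls).length ≤ B)
    (hlB : ∀ cl ∈ cls, ∀ l ∈ cl, l + k + 4 ≤ B) (hxB : x.length ≤ B) (hkB : 2 * k + 1 ≤ B)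
    (hpB : 2 ^ p ≤ B) (hmB : k + cls.length ≤ B) (hmkB : cls.length * k ≤ B) :
    ∃ t s, Exec B (prog k) (Store.init x) t s ∧ Output s (code k p cls) ∧ 2 ^ p ≤ t ∧
      t ≤ 12 + (2 ^ p * 2 + 1 +
        (cls.length * (k * (2 ^ p * (r * 19 + k * 15 + 11) + 15) + 9) + 12)) := by
  subst hp
  obtain ⟨t₁, s₁, ht₁, e₁, hE, hO, h2, h5⟩ := paramProg_spec hx hnB hkB hpkB hk
  obtain ⟨t₂, s₂, ht₂, e₂, -, h₂⟩ := Terminates.loop (B := B) (c := 2) (s := s₁)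
    (P := op .sub 2 2 1) (T := 1)
    (N := 2 ^ (n / k + 2 * k)) (I := fun j s => j ≤ 2 ^ (n / k + 2 * k) ∧
      s.reg 2 = 2 ^ (n / k + 2 * k) - j) (by simpa using h2) (fun j s h => h.2)
    (fun j hj s ⟨_, h⟩ hF => by
      have h1 := (hE.frame hF).reg_one
      refine Terminates.of_safe (P := op .sub 2 2 1) ?_ ?_
      · simp only [Safe, BinOp.eval, h1, h]; omega
      · simp only [run, Store.reg_setReg, BinOp.eval, h1, h, reduceIte]
        exact ⟨hj, by omega⟩)
  have hF₂ := e₂.frame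
  have hpad : 2 ^ (n / k + 2 * k) ≤ t₂ := by
    rw [← h2]
    exact e₂.reg_le_of_loop_sub (by norm_num) hE.reg_one
  obtain ⟨t₃, s₃, ht₃, e₃, h₃⟩ := outputProg_spec (hE.frame hF₂)
    ⟨(hF₂.1 32 rfl).trans hO.1, (hF₂.2 1 rfl).trans hO.2⟩ hx (by simpa using h₂)
    ((hF₂.1 5 rfl).trans h5) hr hB hlB hxB hkB hpB hmB hmkB
  exact ⟨_, s₃, .seq e₁ (.seq e₂ e₃), h₃, by omega, by omega⟩

/-! ### The instance of the reduction -/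

/-- With truncated subtraction, `1 - (b - i + (i - b))` is the indicator of `b = i`, and `1 - hits`
that of no true literal. Only their product triggers the shift by `k`. -/
theorem entry_of_ne_or {k p i a b : ℕ} {cl : List ℕ} (h : b ≠ i ∨ 0 < hits p i a cl) :
    entry k p i a b cl = b := by
  have : (1 - (b - i + (i - b))) * (1 - hits p i a cl) = 0 := by
    rw [Nat.mul_eq_zero]; omega
  simp [entry, this]

theorem entry_of_hits_eq_zero {k p i a : ℕ} {cl : List ℕ} (h : hits p i a cl = 0) :
    entry k p i a i cl = k + i := by
  simp [entry, h]

/-- The one value that may be changed moves to `k + i`, outside the range of the others. Hence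
relations are listed without repetition. -/
theorem entry_injOn {k p i a b b' : ℕ} {cl : List ℕ} (hb : b < k) (hb' : b' < k)
    (h : entry k p i a b cl = entry k p i a b' cl) : b = b' := by
  rcases Nat.eq_zero_or_pos (hits p i a cl) with h0 | h0
  · by_cases h1 : b = i <;> by_cases h2 : b' = i
    · omega
    · subst h1; rw [entry_of_hits_eq_zero h0, entry_of_ne_or (.inl h2)] at h; omega
    · subst h2; rw [entry_of_hits_eq_zero h0, entry_of_ne_or (.inl h1)] at h; omega
    · rwa [entry_of_ne_or (.inl h1), entry_of_ne_or (.inl h2)] at h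
  · rwa [entry_of_ne_or (.inr h0), entry_of_ne_or (.inr h0)] at h

theorem flatMap_finRange {α : Type*} (n : ℕ) (f : ℕ → List α) :
    ((List.finRange n).flatMap fun i : Fin n => f i) = (List.range n).flatMap f := by
  rw [← List.map_coe_finRange_eq_range, List.flatMap_map]

theorem flatMap_product {α β γ : Type*} (l : List α) (l' : List β) (f : α × β → List γ) :
    (l ×ˢ l').flatMap f = l.flatMap fun a => l'.flatMap fun b => f (a, b) := by
  change (l.flatMap fun a => l'.map (Prod.mk a)).flatMap f = _
  simp only [List.flatMap_assoc, List.flatMap_map]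

section Instance

variable {k p : ℕ} (hp : 2 * k ≤ 2 ^ p) (cls : List (List ℕ))

/-- The tuple with index `(a, b)` in the constraint between group `i` and clause `cl`. -/
def tuple (cl : List ℕ) (i : Fin k) (u : Fin (2 ^ p) × Fin k) : Fin 2 → Fin (2 ^ p) :=
  ![u.1, ⟨entry k p i u.1 u.2 cl, by
    have := entry_le (k := k) (p := p) (i := i) (a := u.1) (b := u.2) (cl := cl)
    omega⟩]

theorem tuple_injective (cl : List ℕ) (i : Fin k) : Function.Injective (tuple hp cl i) := by
  rintro ⟨a, b⟩ ⟨a', b'⟩ h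
  have h0 : a = a' := congrFun h 0
  have h1 : entry k p i a b cl = entry k p i a' b' cl := congrArg Fin.val (congrFun h 1)
  subst h0
  rw [Prod.mk.injEq, Fin.ext_iff (a := b)]
  exact ⟨rfl, entry_injOn b.2 b'.2 h1⟩

/-- The constraint between clause `u.1` and group `u.2`. -/
def constr (u : Fin cls.length × Fin k) : CSPConstraint (k + cls.length) (2 ^ p) where
  arity := 2
  scope := ![Fin.castAdd _ u.2, Fin.natAdd _ u.1]
  tuples := (List.finRange (2 ^ p) ×ˢ List.finRange k).map (tuple hp cls[u.1] u.2)
  nodup := ((List.nodup_finRange _).product (List.nodup_finRange _)).map (tuple_injective hp _ _)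

theorem range_scope_constr (u : Fin cls.length × Fin k) :
    Set.range (constr hp cls u).scope = {Fin.castAdd _ u.2, Fin.natAdd _ u.1} := by
  simp [constr, Set.pair_comm]

/-- Group variables lie below `k` and clause variables from `k` on, so the unordered pair determines
both indices. This excludes repeated constraints as well as two constraints on one pair. -/
theorem range_scope_constr_injective :
    Function.Injective fun u => Set.range (constr hp cls u).scope := by
  rintro ⟨j, i⟩ ⟨j', i'⟩ h
  simp only [range_scope_constr] at h
  have h1 : Fin.castAdd cls.length i ∈ ({Fin.castAdd _ i', Fin.natAdd _ j'} : Set _) :=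
    h ▸ Set.mem_insert _ _
  have h2 : Fin.natAdd k j ∈ ({Fin.castAdd _ i', Fin.natAdd _ j'} : Set _) :=
    h ▸ Set.mem_insert_of_mem _ rfl
  simp only [Set.mem_insert_iff, Set.mem_singleton_iff, Fin.ext_iff, Fin.val_castAdd,
    Fin.val_natAdd] at h1 h2
  ext <;> simp only <;> omega

theorem nodup_product (k : ℕ) : (List.finRange cls.length ×ˢ List.finRange k).Nodup :=
  (List.nodup_finRange _).product (List.nodup_finRange _)

/-- The instance for the clauses `cls`, which are lists of codes of literals. -/
def inst : CSPInstance where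
  numVars := k + cls.length
  numVals := 2 ^ p
  constraints := (List.finRange cls.length ×ˢ List.finRange k).map (constr hp cls)
  nodup := (nodup_product cls k).map fun _ _ h =>
    range_scope_constr_injective hp cls (congrArg (fun c => Set.range c.scope) h)

theorem inst_isSimpleBinary : (inst hp cls).IsSimpleBinary := by
  refine ⟨fun c hc => ?_, ?_⟩
  · obtain ⟨⟨j, i⟩, -, rfl⟩ := List.mem_map.1 hc
    refine ⟨rfl, ?_⟩
    have : Fin.castAdd cls.length i ≠ Fin.natAdd k j := by
      intro h; have := congrArg Fin.val h; simp at this; omega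
    intro x y h
    change Fin 2 at x y
    fin_cases x <;> fin_cases y <;> simp_all [constr]
  · exact List.pairwise_map.2 ((nodup_product cls k).imp fun h h' =>
      h (range_scope_constr_injective hp cls h'))

theorem encode_inst : (inst hp cls).encode = code k p cls := by
  have h1 : ∀ cl i, ((List.finRange (2 ^ p) ×ˢ List.finRange k).map (tuple hp cl i)).flatMap
      (fun u => List.ofFn fun i => (u i : ℕ)) = (List.range (2 ^ p)).flatMap (row k p i cl) := by
    intro cl i
    rw [← flatMap_finRange, List.flatMap_map, flatMap_product]
    refine congrArg (fun f => List.flatMap f _) (funext fun a => ?_)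
    rw [row, ← flatMap_finRange]
    simp [tuple]
  have h2 : ∀ u, ((constr hp cls u).arity :: (List.ofFn fun i => ((constr hp cls u).scope i : ℕ)) ++
      (constr hp cls u).tuples.length :: (constr hp cls u).tuples.flatMap
        fun u => List.ofFn fun i => (u i : ℕ)) = constraintCode k p u.1 cls[u.1] u.2 := by
    intro u
    rw [constraintCode, ← h1]
    simp [constr, List.length_product]
  rw [CSPInstance.encode, code]
  simp only [inst, List.flatMap_map, h2]
  rw [← flatMap_finRange, flatMap_product]
  simp only [clauseCode, ← flatMap_finRange, List.length_map]
  simp [List.length_product]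

/-- In a solution, the value of a clause variable must be the index of a group that satisfies the
clause: a dummy value cannot agree with two groups at once. -/
theorem hasSolution_inst (hk : 2 ≤ k) : (inst hp cls).HasSolution ↔
    ∃ g : Fin k → Fin (2 ^ p), ∀ cl ∈ cls, ∃ i : Fin k, 0 < hits p i (g i) cl := by
  have hmem : ∀ f : Fin (k + cls.length) → Fin (2 ^ p),
      (∀ c ∈ (List.finRange cls.length ×ˢ List.finRange k).map (constr hp cls),
        (fun i => f (c.scope i)) ∈ c.tuples) ↔
      ∀ (j : Fin cls.length) (i : Fin k), ∃ b : Fin k, (f (Fin.natAdd k j) : ℕ) =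
        entry k p i (f (Fin.castAdd _ i)) b cls[j] := by
    intro f
    simp only [List.forall_mem_map, Prod.forall]
    refine forall_congr' fun j => forall_congr' fun i => ?_
    have hm : (j, i) ∈ List.finRange cls.length ×ˢ List.finRange k := by simp
    simp only [hm, true_imp_iff]
    have hc : (fun x => f ((constr hp cls (j, i)).scope x)) =
        ![f (Fin.castAdd _ i), f (Fin.natAdd k j)] := by
      funext x; change Fin 2 at x; fin_cases x <;> rfl
    rw [hc]
    change _ ∈ List.map (tuple hp cls[j] i) _ ↔ _
    simp only [List.mem_map, Prod.exists, tuple]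
    constructor
    · rintro ⟨a, b, -, h⟩
      refine ⟨b, ?_⟩
      have h0 : a = f (Fin.castAdd _ i) := congrFun h 0
      have h1 := congrFun h 1
      subst h0
      exact (congrArg Fin.val h1).symm
    · rintro ⟨b, h⟩
      refine ⟨f (Fin.castAdd _ i), b, by simp, ?_⟩
      congr 1
      funext x
      fin_cases x
      exact Fin.ext h.symm
  constructor
  · rintro ⟨f, hf⟩
    replace hf := (hmem f).1 hf
    refine ⟨fun i => f (Fin.castAdd _ i), fun cl hcl => ?_⟩
    obtain ⟨j, rfl⟩ := List.mem_iff_get.1 hcl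
    by_contra! hcon
    -- If no group satisfies the clause, each constraint leaves its own dummy or an index other than
    -- its own.
    have key : ∀ i : Fin k, (f (Fin.natAdd k j) : ℕ) = k + i ∨
        ((f (Fin.natAdd k j) : ℕ) ≠ i ∧ (f (Fin.natAdd k j) : ℕ) < k) := by
      intro i
      obtain ⟨b, hb⟩ := hf j i
      have h0 := Nat.le_zero.1 (hcon i)
      rw [hb]
      by_cases hbi : (b : ℕ) = i
      · left; rw [hbi]; exact entry_of_hits_eq_zero h0
      · right; rw [entry_of_ne_or (.inl hbi)]; exact ⟨hbi, b.2⟩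
    -- A value below `k` violates the constraint with the group it names; a larger one would have to
    -- be the dummy of both group `0` and group `1`.
    have k0 := key ⟨0, by omega⟩
    have k1 := key ⟨1, by omega⟩
    rcases lt_or_ge (f (Fin.natAdd k j) : ℕ) k with h | h
    · have := key ⟨_, h⟩
      simp only at this
      omega
    · simp only at k0 k1
      omega
  · rintro ⟨g, hg⟩
    have hg' : ∀ j : Fin cls.length, ∃ i : Fin k, 0 < hits p i (g i) cls[j] :=
      fun j => hg _ (List.getElem_mem _)
    choose w hw using hg'
    -- Each clause variable names a satisfying group; the index fits in the domain since `2 * k ≤ 2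
    -- ^ p`.
    obtain ⟨f, hfg, hfw⟩ : ∃ f : Fin (k + cls.length) → Fin (2 ^ p),
        (∀ i, f (Fin.castAdd _ i) = g i) ∧ ∀ j, (f (Fin.natAdd k j) : ℕ) = w j :=
      ⟨Fin.addCases g fun j => ⟨w j, (w j).2.trans_le (by omega)⟩, by simp, by simp⟩
    refine ⟨f, (hmem f).2 fun j i => ⟨w j, ?_⟩⟩
    rw [hfg, hfw]
    refine (entry_of_ne_or ?_).symm
    by_cases h : w j = i
    · subst h; exact .inr (hw j)
    · exact .inl fun h' => h (Fin.ext h')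

end Instance

/-! ### Treewidth of the instance -/

/-- A bipartite graph with parts of sizes `k` and `m` has treewidth at most `k`. -/
theorem treewidth_le_of_adj {k m : ℕ} {G : SimpleGraph (Fin (k + m))}
    (hG : ∀ x y, G.Adj x y → ∃ i j, x = Fin.castAdd m i ∧ y = Fin.natAdd k j ∨
      y = Fin.castAdd m i ∧ x = Fin.natAdd k j) : treewidth G ≤ k := by
  classical
  let X : Finset (Fin (k + m)) := Finset.univ.image (Fin.castAdd m)
  have hX : X.card ≤ k := Finset.card_image_le.trans (by simp)
  have hmem : ∀ i, Fin.castAdd m i ∈ X := fun i => Finset.mem_image_of_mem _ (Finset.mem_univ i)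
  have hnot : ∀ j, Fin.natAdd k j ∉ X := by
    intro j h
    obtain ⟨i, -, h⟩ := Finset.mem_image.1 h
    have := congrArg Fin.val h
    simp at this
    omega
  let bag : Option (Fin m) → Finset (Fin (k + m)) :=
    fun t => t.elim X fun j => insert (Fin.natAdd k j) X
  have hbag : ∀ i t, Fin.castAdd m i ∈ bag t := by
    rintro i (_ | j)
    · exact hmem i
    · exact Finset.mem_insert_of_mem (hmem i)
  let D : TreeDecomposition G :=
    { Node := Option (Fin m)
      fintypeNode := inferInstance
      tree := SimpleGraph.starGraph none
      isTree := SimpleGraph.isTree_starGraph _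
      bag := bag
      cover := by
        intro v
        refine Fin.addCases (fun i => ⟨none, hbag i _⟩) (fun j => ⟨some j, ?_⟩) v
        exact Finset.mem_insert_self _ _
      edge := by
        intro v w h
        obtain ⟨i, j, ⟨rfl, rfl⟩ | ⟨rfl, rfl⟩⟩ := hG v w h
        · exact ⟨some j, hbag i _, Finset.mem_insert_self _ _⟩
        · exact ⟨some j, Finset.mem_insert_self _ _, hbag i _⟩
      connected := by
        intro v
        refine Fin.addCases (fun i => ?_) (fun j => ?_) v
        -- A group vertex lies in every bag, so the centre of the star joins them; a clause vertex
        -- lies in a single leaf bag.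
        · refine SimpleGraph.Connected.of_isUniversal (v := (⟨none, by exact hbag i none⟩ : {t // t ∈ {t | Fin.castAdd m i ∈ bag t}})) ?_
          rintro ⟨w, hw⟩ h
          simp only [SimpleGraph.comap_adj, Function.Embedding.subtype_apply,
            SimpleGraph.starGraph_adj]
          exact ⟨fun h' => h (Subtype.ext h'), .inl trivial⟩
        · refine SimpleGraph.Connected.of_isUniversal
            (v := (⟨some j, by exact Finset.mem_insert_self (Fin.natAdd k j) X⟩ : {t // t ∈ {t | Fin.natAdd k j ∈ bag t}})) ?_
          rintro ⟨w, hw⟩ h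
          exfalso
          rcases w with _ | j'
          · exact hnot _ hw
          · rcases Finset.mem_insert.1 (show Fin.natAdd k j ∈ insert (Fin.natAdd k j') X from hw) with h' | h'
            · exact h (Subtype.ext (congrArg some (Fin.natAdd_injective _ _ h')))
            · exact hnot _ h' }
  refine (iInf_le _ D).trans ?_
  rw [Nat.cast_le]
  refine Finset.sup_le fun t _ => ?_
  rcases t with _ | j
  · exact (Nat.sub_le _ _).trans hX
  · exact Nat.sub_le_of_le_add ((Finset.card_insert_le _ _).trans (Nat.succ_le_succ hX))

theorem treewidth_inst {k p : ℕ} (hp : 2 * k ≤ 2 ^ p) (cls : List (List ℕ)) :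
    treewidth (inst hp cls).primalGraph ≤ k := by
  refine treewidth_le_of_adj (m := cls.length) fun x y ⟨hne, c, hc, hx, hy⟩ => ?_
  obtain ⟨⟨j, i⟩, -, rfl⟩ := List.mem_map.1 hc
  replace hx := (range_scope_constr hp cls (j, i)).le hx
  replace hy := (range_scope_constr hp cls (j, i)).le hy
  refine ⟨i, j, ?_⟩
  rcases hx with rfl | rfl <;> rcases hy with rfl | rfl
  · exact absurd rfl hne
  · exact .inl ⟨rfl, rfl⟩
  · exact .inr ⟨rfl, rfl⟩
  · exact absurd rfl hne

/-! ### Satisfiability in terms of assignments to groups -/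

/-- The clauses of a formula, as lists of codes of literals. -/
def codedClauses (φ : CNF) : List (List ℕ) :=
  φ.clauses.map fun c => c.map fun l => 2 * (l.1 : ℕ) + l.2.toNat

theorem encode_eq (φ : CNF) :
    φ.encode = [φ.numVars, (codedClauses φ).length] ++ clausesCode (codedClauses φ) := by
  simp [CNF.encode, codedClauses, clausesCode, List.flatMap_map]

/-- A sum of the two truncated differences of two numbers vanishes exactly if they are equal, so
`litVal` tests the group and the truth value at once. -/
theorem litVal_pos_iff {p i a v : ℕ} {b : Bool} :
    0 < litVal p i a (2 * v + b.toNat) ↔ v / p = i ∧ a.testBit (v % p) = b := by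
  have h1 : (2 * v + b.toNat) / 2 = v := by have := b.toNat_lt; omega
  have h2 : (2 * v + b.toNat) % 2 = b.toNat := by cases b <;> simp
  have h3 : a >>> (v % p) % 2 = (a.testBit (v % p)).toNat := by
    rw [Nat.toNat_testBit, Nat.shiftRight_eq_div_pow]
  rw [litVal, h1, h2, h3]
  cases b <;> cases a.testBit (v % p) <;> simp; all_goals omega

theorem hits_pos_iff {p i a : ℕ} {cl : List ℕ} :
    0 < hits p i a cl ↔ ∃ l ∈ cl, 0 < litVal p i a l := by
  simp only [Nat.pos_iff_ne_zero, hits, ne_eq, List.sum_eq_zero_iff, List.forall_mem_map]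
  push Not
  rfl

/-- Variable `v` is bit `v % p` of the code for group `v / p`. Bits beyond the last variable are
irrelevant and set to `false`. -/
theorem satisfiable_iff {φ : CNF} {k p : ℕ} (hp : 0 < p) (hn : φ.numVars ≤ p * k) :
    φ.Satisfiable ↔ ∃ g : Fin k → Fin (2 ^ p), ∀ cl ∈ codedClauses φ,
      ∃ i : Fin k, 0 < hits p i (g i) cl := by
  simp only [CNF.Satisfiable, codedClauses, List.forall_mem_map, hits_pos_iff]
  simp only [List.mem_map, exists_exists_and_eq_and, litVal_pos_iff]
  constructor
  · rintro ⟨a, ha⟩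
    refine ⟨fun i => ⟨Nat.ofBits fun q : Fin p =>
      if h : i * p + q < φ.numVars then a ⟨i * p + q, h⟩ else false, Nat.ofBits_lt_two_pow _⟩,
      fun cl hcl => ?_⟩
    obtain ⟨l, hl, hal⟩ := ha cl hcl
    have hlt : (l.1 : ℕ) / p < k := Nat.div_lt_of_lt_mul (l.1.2.trans_le hn)
    refine ⟨⟨_, hlt⟩, l, hl, rfl, ?_⟩
    rw [Nat.testBit_ofBits_lt _ _ (Nat.mod_lt _ hp)]
    have : (l.1 : ℕ) / p * p + l.1 % p = l.1 := Nat.div_add_mod' _ _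
    simp [this, hal]
  · rintro ⟨g, hg⟩
    have hlt : ∀ v : Fin φ.numVars, (v : ℕ) / p < k :=
      fun v => Nat.div_lt_of_lt_mul (v.2.trans_le hn)
    refine ⟨fun v => (g ⟨_, hlt v⟩ : ℕ).testBit (v % p), fun cl hcl => ?_⟩
    obtain ⟨i, l, hl, hi, h⟩ := hg cl hcl
    refine ⟨l, hl, ?_⟩
    have : i = ⟨_, hlt l.1⟩ := Fin.ext hi.symm
    rw [← h, this]

/-! ### Correctness and running time -/

theorem foldr_max_le {l : List ℕ} {M : ℕ} (h : ∀ v ∈ l, v ≤ M) : l.foldr max 0 ≤ M := by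
  induction l with
  | nil => simp
  | cons a l ih =>
    rw [List.foldr_cons]
    exact max_le (h a (by simp)) (ih fun v hv => h v (by simp [hv]))

theorem le_foldr_max {l : List ℕ} {v : ℕ} (h : v ∈ l) : v ≤ l.foldr max 0 := by
  induction l with
  | nil => simp at h
  | cons a l ih =>
    rw [List.foldr_cons]
    rcases List.mem_cons.1 h with rfl | h
    · exact le_max_left _ _
    · exact (ih h).trans (le_max_right _ _)

theorem le_inputSize {x : List ℕ} {v : ℕ} (h : v ∈ x) : v ≤ inputSize x :=
  (le_foldr_max h).trans (Nat.le_add_left _ _)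

theorem le_of_mem_code {k p v : ℕ} {cls : List (List ℕ)} (h : v ∈ code k p cls) :
    v ≤ 2 + 2 * k + cls.length + cls.length * k + 2 ^ p + 2 ^ p * k := by
  simp only [code, clauseCode, constraintCode, row, List.mem_append, List.mem_flatMap,
    List.mem_range, List.mem_cons, List.not_mem_nil, or_false] at h
  rcases h with (h | h | h) | ⟨j, hj, i, hi, (h | h | h | h) | ⟨a, ha, b, hb, h | h⟩⟩
  on_goal 9 => have := entry_le (k := k) (p := p) (i := i) (a := a) (b := b) (cl := cls.getD j [])
  all_goals
    generalize 2 ^ p * k = u at *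
    generalize cls.length * k = u' at *
    generalize 2 ^ p = d at *
    omega

/-- A renamed program does not use the registers and arrays of the reduction. -/
theorem exec_shift {B k t : ℕ} {P : Prog} {x y : List ℕ} {s σ : Store} {t' : ℕ}
    (h : Exec B (prog k) (Store.init x) t s) (hO : Output s y)
    (hP : Exec B P (Store.init y) t' σ) :
    ∃ s', Exec B (P.shift 32 1) s t' s' ∧ s'.reg 32 = σ.reg 0 := by
  -- Renaming turns register `0` and array `0` into register `32` and array `1`, which hold the
  -- output. All later registers and arrays are untouched, hence still zero.
  obtain ⟨s', he, hr, -⟩ := hP.shift 32 1 (σ := s)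
    (by
      intro r
      rcases Nat.eq_zero_or_pos r with rfl | hr
      · simpa [Store.init] using hO.1
      · rw [h.frame.1 (r + 32)]
        · simp [Store.init, hr.ne']
        · simp [prog, paramProg, padProg, outputProg, clauseProg, constraintProg, rowProg,
            tupleProg, litProg, emit, block, writesReg]
          omega)
    (by
      intro A
      rcases Nat.eq_zero_or_pos A with rfl | hA
      · rw [zero_add, hO.2]; funext i; simp [Store.init, arrOf]
      · rw [h.frame.2 (A + 1)]
        · funext i; simp [Store.init, hA.ne']
        · simp [prog, paramProg, padProg, outputProg, clauseProg, constraintProg, rowProg,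
            tupleProg, litProg, emit, block, writesArr]
          omega)
  exact ⟨s', he, hr 0⟩

/-! ### Estimates for running time and word length -/

/-- There are at most `(2 * n + 1) ^ r` clauses with at most `r` literals on `n` variables. -/
theorem length_clauses_le {φ : CNF} {r : ℕ} (h : φ.IsKCNF r) :
    φ.clauses.length ≤ (2 * φ.numVars + 1) ^ r := by
  -- Padding a clause with `none` to length `r` loses nothing and leaves `2 * n + 1` choices per
  -- position.
  let f : List (Fin φ.numVars × Bool) → Fin r → Option (Fin φ.numVars × Bool) :=
    fun l i => l[(i : ℕ)]?
  have hf : ∀ l ∈ φ.clauses, ∀ l' ∈ φ.clauses, f l = f l' → l = l' := by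
    intro l hl l' hl' hll
    refine List.ext_getElem? fun i => ?_
    by_cases hi : i < r
    · exact congrFun hll ⟨i, hi⟩
    · rw [List.getElem?_eq_none ((h l hl).trans (not_lt.1 hi)),
        List.getElem?_eq_none ((h l' hl').trans (not_lt.1 hi))]
  have := (φ.nodup.map_on hf).length_le_card
  simpa [mul_comm] using this

theorem exists_pow_le_two_rpow (s : ℕ) {γ : ℝ} (hγ : 0 < γ) :
    ∃ C : ℝ, 0 ≤ C ∧ ∀ n : ℕ, (2 * n + 1 : ℝ) ^ s ≤ C * 2 ^ (γ * n) := by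
  rcases Nat.eq_zero_or_pos s with rfl | hs
  · refine ⟨1, zero_le_one, fun n => ?_⟩
    simpa using Real.one_le_rpow one_le_two (by positivity : 0 ≤ γ * n)
  have hL : 0 < Real.log 2 := Real.log_pos one_lt_two
  have hs' : (0 : ℝ) < s := by exact_mod_cast hs
  -- Chosen so that the `s`-th power of `exp (u * n)` is `2 ^ (γ * n)`.
  set u := γ * Real.log 2 / s with hu
  have hu0 : 0 < u := by positivity
  refine ⟨(1 + 2 / u) ^ s, by positivity, fun n => ?_⟩
  have h1 : (2 * n + 1 : ℝ) ≤ (1 + 2 / u) * Real.exp (u * n) := by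
    have h2 := Real.add_one_le_exp (u * n)
    have h3 : (2 * n + 1 : ℝ) ≤ (1 + 2 / u) * (u * n + 1) := by
      have : (1 + 2 / u) * (u * n + 1) = u * n + 1 + 2 * n + 2 / u := by field_simp; ring
      rw [this]
      have : 0 ≤ u * n + 2 / u := by positivity
      linarith
    exact h3.trans (by gcongr)
  calc (2 * n + 1 : ℝ) ^ s ≤ ((1 + 2 / u) * Real.exp (u * n)) ^ s := by gcongr
    _ = (1 + 2 / u) ^ s * 2 ^ (γ * n) := by
      rw [mul_pow, ← Real.exp_nat_mul, Real.rpow_def_of_pos two_pos]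
      congr 2
      rw [hu]
      field_simp

/-- The first summand is the cost of the reduction, the second that of the assumed algorithm. Of the
saving `ε / k` in the exponent, half pays for the polynomial factors. -/
theorem exists_time_bound {k c : ℕ} (r : ℕ) (hk : 2 ≤ k) (hc : 1 ≤ c) {ε : ℝ} (hε : 0 < ε)
    (hε1 : ε ≤ 1) {A K : ℝ} (hA : 0 ≤ A) (hK : 0 ≤ K) :
    ∃ K' : ℝ, ∀ n m : ℕ, m ≤ (2 * n + 1) ^ r →
      A * (m + 1) * 2 ^ (n / k + 2 * k) +
        K * ((k + m : ℕ) : ℝ) ^ c * ((2 ^ (n / k + 2 * k) : ℕ) : ℝ) ^ ((k : ℝ) - ε) ≤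
      K' * 2 ^ ((1 - ε / (2 * k)) * n) := by
  have hk2 : (2 : ℝ) ≤ k := by exact_mod_cast hk
  have hk0 : (0 : ℝ) < k := by linarith
  obtain ⟨C, hC, hpoly⟩ := exists_pow_le_two_rpow (r * c) (γ := ε / (2 * k)) (by positivity)
  -- With `Q = (2 * n + 1) ^ r`, the factors come from `m + 1 ≤ 2 * Q`, from `k + m ≤ (k + 1) * Q`,
  -- and from the `2 * k` extra bits per group.
  refine ⟨(2 * A + K * (k + 1) ^ c) * (C * 2 ^ (2 * k * k : ℝ)), fun n m hm => ?_⟩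
  set Q : ℝ := (2 * n + 1) ^ r with hQ
  have hQ1 : 1 ≤ Q := one_le_pow₀ (by linarith [n.cast_nonneg (α := ℝ)])
  have hmQ : (m : ℝ) ≤ Q := by rw [hQ]; exact_mod_cast hm
  set D : ℝ := 2 ^ (n / k + 2 * k) with hD
  have hD1 : 1 ≤ D := one_le_pow₀ one_le_two
  have hcast : ((2 ^ (n / k + 2 * k) : ℕ) : ℝ) = D := by push_cast; rfl
  rw [hcast]
  -- As `k - ε ≥ 1`, writing the instance costs no more than solving it.
  have hDE : D ≤ D ^ ((k : ℝ) - ε) := by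
    conv_lhs => rw [← Real.rpow_one D]
    exact Real.rpow_le_rpow_of_exponent_le hD1 (by linarith)
  set E : ℝ := D ^ ((k : ℝ) - ε) with hE
  have hE0 : 0 ≤ E := by positivity
  have hEb : E ≤ 2 ^ (2 * k * k : ℝ) * 2 ^ ((1 - ε / k) * n) := by
    rw [hE, hD, ← Real.rpow_natCast, ← Real.rpow_mul two_pos.le, ← Real.rpow_add two_pos]
    refine Real.rpow_le_rpow_of_exponent_le one_le_two ?_
    have h1 : ((n / k : ℕ) : ℝ) ≤ n / k := Nat.cast_div_le
    push_cast
    calc (((n / k : ℕ) : ℝ) + 2 * k) * (k - ε) ≤ (n / k + 2 * k) * (k - ε) := by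
          gcongr; linarith
      _ = 2 * k * k + (1 - ε / k) * n - 2 * k * ε := by field_simp; ring
      _ ≤ _ := by have : 0 ≤ 2 * k * ε := by positivity
                  linarith
  have hQc : Q ≤ Q ^ c := le_self_pow₀ hQ1 (by omega)
  have hQp : Q ^ c ≤ C * 2 ^ (ε / (2 * k) * n) := by
    rw [hQ, ← pow_mul]; exact hpoly n
  have h1 : A * (m + 1) * D ≤ A * (2 * Q ^ c) * E := by
    gcongr; linarith
  have h2 : K * ((k + m : ℕ) : ℝ) ^ c * E ≤ K * ((k + 1) ^ c * Q ^ c) * E := by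
    rw [← mul_pow]
    gcongr
    push_cast
    nlinarith
  calc _ ≤ (2 * A + K * (k + 1) ^ c) * (Q ^ c * E) := by linarith
    _ ≤ (2 * A + K * (k + 1) ^ c) * ((C * 2 ^ (ε / (2 * k) * n)) *
        (2 ^ (2 * k * k : ℝ) * 2 ^ ((1 - ε / k) * n))) := by gcongr
    _ = (2 * A + K * (k + 1) ^ c) * (C * 2 ^ (2 * k * k : ℝ)) *
        (2 ^ (ε / (2 * k) * n) * 2 ^ ((1 - ε / k) * n)) := by ring
    _ = _ := by
      rw [← Real.rpow_add two_pos]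
      congr 2
      field_simp
      ring

/-- Here `X` stands for input size plus total time. Only polynomiality matters, so the exponents are
generous: the words used by the reduction and by the simulated algorithm are then admissible for the
composite. -/
theorem code_bounds {k p m X : ℕ} {cls : List (List ℕ)} (hm : cls.length = m) (hmX : m ≤ X)
    (hkp : 2 * k ≤ 2 ^ p) (hpX : 2 ^ p ≤ X) (hX : 4 ≤ X) :
    inputSize (code k p cls) ≤ X ^ 7 ∧
      X + (code k p cls).length + 2 ^ p * k + (k + m) + m * k + (2 * k + 1) + 4 ≤ X ^ 8 := by
  have hkX : 2 * k ≤ X := hkp.trans hpX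
  have hpk : 2 ^ p * k ≤ X ^ 2 := by rw [sq]; exact Nat.mul_le_mul hpX (by omega)
  have hmk : m * k ≤ X ^ 2 := by rw [sq]; exact Nat.mul_le_mul hmX (by omega)
  have e1 : X ≤ X ^ 2 := Nat.le_self_pow (by norm_num) X
  have e : ∀ i, 4 * X ^ i ≤ X ^ (i + 1) := fun i => by
    rw [pow_succ, mul_comm]; exact Nat.mul_le_mul_left _ hX
  have e2 : 4 * X ^ 2 ≤ X ^ 3 := e 2
  have e3 : 4 * X ^ 3 ≤ X ^ 4 := e 3
  have e4 : 4 * X ^ 4 ≤ X ^ 5 := e 4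
  have e5 : 4 * X ^ 5 ≤ X ^ 6 := e 5
  have e6 : 4 * X ^ 6 ≤ X ^ 7 := e 6
  have e7 : 4 * X ^ 7 ≤ X ^ 8 := e 7
  have h1 : (code k p cls).length ≤ X ^ 6 := by
    rw [length_code, hm]
    calc 3 + m * (k * (4 + 2 ^ p * (k * 2))) ≤ 3 + X * (X * (4 + X * (X * 2))) := by
          gcongr <;> omega
      _ = 3 + 4 * X ^ 2 + 2 * X ^ 4 := by ring
      _ ≤ X ^ 6 := by omega
  have h2 : (code k p cls).foldr max 0 ≤ X ^ 6 := foldr_max_le fun v hv => by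
    have := le_of_mem_code hv
    rw [hm] at this
    omega
  refine ⟨?_, ?_⟩
  · rw [inputSize]; omega
  · omega

/-- The reduction turns an algorithm for binary instances of treewidth `k` into one for
`r`-SAT. -/
theorem solvableInTime_sat {k c : ℕ} (hk : 2 ≤ k) (hc : 1 ≤ c) {ε : ℝ} (hε : 0 < ε) (hε1 : ε ≤ 1)
    {S : Set CSPInstance}
    (hS : ∀ I : CSPInstance, I.IsSimpleBinary → 0 < I.numVars → 0 < I.numVals →
      treewidth I.primalGraph ≤ k → I ∈ S)
    (halg : SolvableInTime S CSPInstance.encode CSPInstance.HasSolution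
      (fun I => (I.numVars : ℝ) ^ c * (I.numVals : ℝ) ^ ((k : ℝ) - ε))) (r : ℕ) :
    SolvableInTime {φ : CNF | φ.IsKCNF r} CNF.encode CNF.Satisfiable
      fun φ => (2 : ℝ) ^ ((1 - ε / (2 * k)) * (φ.numVars : ℝ)) := by
  obtain ⟨P, w, K, hP⟩ := halg
  set A : ℕ := 30 + (k * (r * 19 + k * 15 + 26) + 9) with hA
  obtain ⟨K', hK'⟩ := exists_time_bound r hk hc hε hε1 (A := A) (K := |K|) (by positivity)
    (abs_nonneg K)
  refine ⟨seq (prog k) (seq (P.shift 32 1) (ite 32 (const 0 1) (const 0 0))), 8 * w + 8, K',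
    fun φ hφ => ?_⟩
  set n := φ.numVars with hn
  set cls := codedClauses φ with hcls
  -- The summand `2 * k` makes `k` groups cover all variables despite rounding, and makes the domain
  -- large enough for the `k` indices and `k` dummies.
  set p := n / k + 2 * k with hp
  have hk0 : 0 < k := by omega
  have hkp : 2 * k ≤ 2 ^ p :=
    (Nat.lt_two_pow_self (n := 2 * k)).le.trans (Nat.pow_le_pow_right two_pos (Nat.le_add_left _ _))
  have hp0 : 0 < p := Nat.add_pos_right _ (by omega)
  have hnp : n ≤ p * k := by
    have h1 := Nat.lt_div_mul_add (a := n) hk0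
    have h2 : k ≤ 2 * k * k := Nat.le_mul_of_pos_left k (by omega)
    rw [hp, add_mul]
    omega
  have hmlen : cls.length = φ.clauses.length := by simp [hcls, codedClauses]
  obtain ⟨t₂, s₂, e₂, hyes, ht₂⟩ := hP (inst hkp cls) (hS _ (inst_isSimpleBinary hkp cls)
    (Nat.add_pos_left hk0 _) (pow_pos two_pos p) (treewidth_inst hkp cls))
  rw [encode_inst] at e₂
  have hx := encode_eq φ
  rw [← hn, ← hcls] at hx
  generalize φ.encode = x at *
  have hnx : n ≤ inputSize x := le_inputSize (by simp [hx])
  have hmx : cls.length ≤ inputSize x := le_inputSize (by simp [hx])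
  have hlx : ∀ cl ∈ cls, ∀ l ∈ cl, l ≤ inputSize x := fun cl hcl l hl =>
    le_inputSize (by
      simp only [hx, clausesCode, List.mem_append, List.mem_flatMap]
      exact .inr ⟨cl, hcl, List.mem_cons_of_mem _ hl⟩)
  have hxx : x.length ≤ inputSize x := Nat.le_add_right _ _
  have hr : ∀ cl ∈ cls, cl.length ≤ r := by
    simp only [hcls, codedClauses, List.forall_mem_map, List.length_map]
    exact hφ
  have hDk : 2 ^ p ≤ 2 ^ p * k := Nat.le_mul_of_pos_right _ hk0
  obtain ⟨t₁, s₁, e₁, hO, hpt, ht₁⟩ := prog_spec (B := inputSize x + (code k p cls).length +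
    2 ^ p * k + (k + cls.length) + cls.length * k + (2 * k + 1) + 4) hp hx (by omega) (by omega)
    hk0 hr (by omega) (fun cl hcl l hl => by have := hlx cl hcl l hl; omega) (by omega) (by omega)
    (by omega) (by omega) (by omega)
  set X := inputSize x + (t₁ + (t₂ + (1 + 1))) + 1 with hX
  obtain ⟨hb2, hb3⟩ := code_bounds (k := k) (p := p) (X := X) (cls := cls) rfl (by omega) hkp
    (by omega) (by omega)
  have hX0 : 0 < X := by omega
  have hB₁ : inputSize x + (code k p cls).length + 2 ^ p * k + (k + cls.length) +
      cls.length * k + (2 * k + 1) + 4 ≤ X ^ (8 * w + 8) :=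
    le_trans (by omega) (hb3.trans (Nat.pow_le_pow_right hX0 (by omega)))
  -- The simulated algorithm is entitled to words polynomial in the size of the constructed
  -- instance, which is itself at most `X ^ 7`.
  have hB₂ : (inputSize (code k p cls) + t₂ + 1) ^ w ≤ X ^ (8 * w + 8) := by
    have : inputSize (code k p cls) + t₂ + 1 ≤ X ^ 8 := by
      have h1 : 2 * X ^ 7 ≤ X ^ 8 := by
        rw [pow_succ X 7, mul_comm]; exact Nat.mul_le_mul_left _ (by omega)
      have h2 : X ≤ X ^ 7 := Nat.le_self_pow (by norm_num) X
      omega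
    calc _ ≤ (X ^ 8) ^ w := Nat.pow_le_pow_left this w
      _ = X ^ (8 * w) := (pow_mul _ _ _).symm
      _ ≤ _ := Nat.pow_le_pow_right hX0 (by omega)
  replace e₁ := e₁.mono hB₁
  obtain ⟨s₃, e₃, h₃⟩ := exec_shift e₁ hO (e₂.mono hB₂)
  have hsat : s₃.reg 32 ≠ 0 ↔ φ.Satisfiable := by
    rw [h₃, hyes, hasSolution_inst hkp cls hk, satisfiable_iff hp0 hnp]
  have htime : ((t₁ + (t₂ + (1 + 1)) : ℕ) : ℝ) ≤
      K' * 2 ^ ((1 - ε / (2 * k)) * (φ.numVars : ℝ)) := by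
    have hm : cls.length ≤ (2 * n + 1) ^ r := hmlen.trans_le (length_clauses_le hφ)
    refine le_trans ?_ (hK' n cls.length hm)
    have h1 : t₁ + 2 ≤ A * (cls.length + 1) * 2 ^ p := by
      have hD : 1 ≤ 2 ^ p := Nat.one_le_two_pow
      calc t₁ + 2 ≤ 28 * 2 ^ p + cls.length *
            (k * (2 ^ p * (r * 19 + k * 15 + 11) + 15 * 2 ^ p) + 9 * 2 ^ p) := by
            have : cls.length * (k * (2 ^ p * (r * 19 + k * 15 + 11) + 15) + 9) ≤ cls.length *
              (k * (2 ^ p * (r * 19 + k * 15 + 11) + 15 * 2 ^ p) + 9 * 2 ^ p) := by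
              gcongr <;> omega
            omega
        _ = (28 + cls.length * (k * (r * 19 + k * 15 + 26) + 9)) * 2 ^ p := by ring
        _ ≤ A * (cls.length + 1) * 2 ^ p := by
          refine Nat.mul_le_mul_right _ ?_
          rw [hA]
          nlinarith [Nat.zero_le cls.length, Nat.zero_le (k * (r * 19 + k * 15 + 26))]
    have h2 : (t₂ : ℝ) ≤ |K| * ((k + cls.length : ℕ) : ℝ) ^ c *
        ((2 ^ p : ℕ) : ℝ) ^ ((k : ℝ) - ε) := by
      refine ht₂.trans ?_
      rw [mul_assoc]
      exact mul_le_mul_of_nonneg_right (le_abs_self K) (by positivity)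
    have h1' : ((t₁ + 2 : ℕ) : ℝ) ≤ A * (cls.length + 1) * 2 ^ p := by exact_mod_cast h1
    push_cast at h1' h2 ⊢
    linarith
  have hB1 : 1 ≤ X ^ (8 * w + 8) := Nat.one_le_pow _ _ hX0
  by_cases h : s₃.reg 32 = 0
  · exact ⟨_, _, .seq e₁ (.seq e₃ (.iteFalse h (.const _ _ _ (Nat.zero_le _)))),
      by simpa [h] using hsat, htime⟩
  · exact ⟨_, _, .seq e₁ (.seq e₃ (.iteTrue h (.const _ _ _ hB1))),
      by simpa [h] using hsat, htime⟩

end Reduction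

/-! ### Conclusion for SETH -/

theorem SolvableInTime.mono {α : Type} {S : Set α} {enc : α → List ℕ} {yes : α → Prop}
    {f g : α → ℝ} (h : SolvableInTime S enc yes f) (hf : ∀ a ∈ S, 0 ≤ f a)
    (hfg : ∀ a ∈ S, f a ≤ g a) : SolvableInTime S enc yes g := by
  obtain ⟨P, w, K, hP⟩ := h
  refine ⟨P, w, |K|, fun a ha => ?_⟩
  obtain ⟨t, s, he, hy, ht⟩ := hP a ha
  refine ⟨t, s, he, hy, ht.trans ?_⟩
  exact mul_le_mul (le_abs_self K) (hfg a ha) (hf a ha) (abs_nonneg K)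

theorem mainTheorem1 (k c : ℕ) (hk : 3 ≤ k) (hc : 1 ≤ c) (ε : ℝ) (hε : 0 < ε)
    (𝒞 : Set CSPInstance) (h𝒞 : ∀ I : CSPInstance, I.IsSimpleBinary → I ∈ 𝒞)
    (halg : SolvableInTime
      {I : CSPInstance | I ∈ 𝒞 ∧ 0 < I.numVars ∧ 0 < I.numVals ∧ treewidth I.primalGraph ≤ (k : ℕ∞)}
      CSPInstance.encode CSPInstance.HasSolution
      (fun I => (I.numVars : ℝ) ^ c * (I.numVals : ℝ) ^ ((k : ℝ) - ε))) :
    ¬ SETH := by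
  intro hSETH
  -- Since domains are nonempty, decreasing `ε` only relaxes the time bound, so `ε` may be capped at
  -- `1`.
  have hδ : 0 < min ε 1 := lt_min hε one_pos
  have hk0 : (0 : ℝ) < k := by exact_mod_cast (by omega : 0 < k)
  have halg' := halg.mono (g := fun I => (I.numVars : ℝ) ^ c * (I.numVals : ℝ) ^ ((k : ℝ) - min ε 1))
    (fun I _ => by positivity) (fun I hI => by
      have : (1 : ℝ) ≤ I.numVals := by exact_mod_cast hI.2.2.1
      have h := Real.rpow_le_rpow_of_exponent_le this (sub_le_sub_left (min_le_left ε 1) (k : ℝ))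
      exact mul_le_mul_of_nonneg_left h (by positivity))
  have hle : ∀ r, satExponent r ≤ ((1 - min ε 1 / (2 * k) : ℝ) : EReal) := fun r =>
    sInf_le (Set.mem_image_of_mem _ (by
      refine Reduction.solvableInTime_sat (by omega) hc hδ (min_le_right _ _) ?_ halg' r
      exact fun I h1 h2 h3 h4 => ⟨h𝒞 I h1, h2, h3, h4⟩))
  have h1 : (1 : EReal) ≤ ((1 - min ε 1 / (2 * k) : ℝ) : EReal) :=
    le_of_tendsto' hSETH hle
  rw [← EReal.coe_one, EReal.coe_le_coe_iff] at h1
  have : 0 < min ε 1 / (2 * k) := by positivity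
  linarith
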